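/- Let $M$ be a smooth manifold (real, finite-dimensional, Hausdorff, second countable, without boundary). Let $\mathfrak X(M)$ be the space of smooth vector fields, $\Lambda^*M$ the algebra of real differential forms with exterior derivative $d$, and $\Lambda^kM\otimes TM$ the $TM$-valued $k$-forms; $\Lambda^1M\otimes TM$ is identified with $\mathrm{End}(TM)$. Let $\mathcal D^k(M)$ be the space of graded derivations of degree $k$ of $\Lambda^*M$, with $[P,Q]=PQ-(-1)^{|P||Q|}QP$. For $\Phi\in\Lambda^kM\otimes TM$ let $\mathcal I_\Phi\in\mathcal D^{k-1}(M)$ and $\mathcal L_\Phi=[\mathcal I_\Phi,d]\in\mathcal D^k(M)$ be the derivations determined, by linearity, by $$\mathcal I_{\alpha\otimes X}\sigma=\alpha\wedge\iota_X\sigma,\qquad \mathcal L_{\alpha\otimes X}\sigma=\alpha\wedge\mathcal L_X\sigma+(-1)^{|\alpha|}d\alpha\wedge\iota_X\sigma .$$ Every $D\in\mathcal D^k(M)$ is uniquely $D=\mathcal L_\Phi+\mathcal I_\Psi$ with $\Phi\in\Lambda^kM\otimes TM$, $\Psi\in\Lambda^{k+1}M\otimes TM$; put $\aleph(D)=(-1)^k\mathcal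 I_\Phi$. The Frölicher–Nijenhuis bracket $[\Phi,\Psi]_{\mathcal{FN}}$ is the unique form with $\mathcal L_{[\Phi,\Psi]_{\mathcal{FN}}}=[\mathcal L_\Phi,\mathcal L_\Psi]$. An endomorphism $R$ of $TM$ acts on $\Lambda^pM$ by $(R\sigma)(V_1,\dots,V_p)=\sigma(RV_1,\dots,RV_p)$ and on $\Psi\in\Lambda^pM\otimes TM$, $p\ge1$, by $(R\Psi)(V_1,\dots,V_p)=R(\Psi(V_1,\dots,V_p))$. Let $\Phi\in\Lambda^1M\otimes TM$ be such that $R_\Phi=\mathrm{Id}_{TM}+\Phi$ is invertible and $\sum_{h=0}^\infty(-1)^h\Phi^h=R_\Phi^{-1}$. Let $e_\Phi=R_\Phi\,d\,R_\Phi^{-1}-d$ be the canonical solution of the Maurer–Cartan equation associated to $\Phi$, and let $b(\Phi)=-\tfrac12R_\Phi^{-1}[\Phi,\Phi]_{\mathcal{FN}}$. Define inductively $$\gamma_1=\mathcal L_\Phi,\qquad \gamma_k=-\tfrac12\sum_{p+q=k,\ p,q\ge1}\aleph\big([\gamma_p,\gamma_q]\big)\quad(k\ge2).$$ Then: a) $\gamma_k\in\mathcal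 D^1(M)$ for all $k\ge1$, and $e_\Phi=\sum_{k=1}^\infty\gamma_k$; b) $\gamma_k=(-1)^{k+1}\tfrac12\,\mathcal I_{\Phi^{k-2}[\Phi,\Phi]_{\mathcal{FN}}}$ for all $k\ge2$; c) $\mathcal I_{b(\Phi)}=\sum_{k=2}^\infty\gamma_k$. Here the infinite sums are limits of partial sums, either all pointwise on $M$ or all in the $C^\infty$ topology (locally uniform convergence of all derivatives), applied to the coefficients $\alpha(\Phi^hX)$ ($\alpha$ a $1$-form, $X$ a vector field) in the hypothesis and $(\gamma_k\sigma)(V_1,\dots,V_q)$ ($\sigma$ a form, $V_i$ vector fields) in the conclusions; the statement holds for each of the two notions of convergence. -/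

import Mathlib

open scoped Manifold ContDiff

noncomputable section Calculus

variable (E : Type*) [NormedAddCommGroup E] [NormedSpace ℝ E]
  (M : Type*) [TopologicalSpace M] [ChartedSpace E M]

/-- The algebra `C^∞(M)` of smooth real functions. -/
abbrev SmoothFn : Type _ := C^∞⟮𝓘(ℝ, E), M; 𝓘(ℝ, ℝ), ℝ⟯

theorem SmoothFn.mdiff {E : Type*} [NormedAddCommGroup E] [NormedSpace ℝ E] {M : Type*}
    [TopologicalSpace M] [ChartedSpace E M] (f : SmoothFn E M) (x : M) :
    MDifferentiableAt 𝓘(ℝ, E) 𝓘(ℝ, ℝ) f x :=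
  f.contMDiff.mdifferentiable (by simp) x

variable [IsManifold 𝓘(ℝ, E) ∞ M]

/-- The space `𝔛(M)` of smooth vector fields. -/
abbrev SmoothVF : Type _ :=
  ContMDiffSection 𝓘(ℝ, E) E ∞ (TangentSpace 𝓘(ℝ, E) : M → Type _)

variable {E M}

namespace SmoothVF

instance : SMul (SmoothFn E M) (SmoothVF E M) where
  smul f X := ⟨fun x => f x • X x, f.contMDiff.smul_section X.contMDiff⟩

theorem smul_apply (f : SmoothFn E M) (X : SmoothVF E M) (x : M) :
    (f • X) x = f x • X x := rfl

instance : Module (SmoothFn E M) (SmoothVF E M) where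
  one_smul X := by ext x; exact one_smul ℝ (X x)
  mul_smul f g X := by ext x; exact mul_smul (f x) (g x) (X x)
  smul_zero f := by ext x; exact smul_zero (f x)
  smul_add f X Y := by ext x; exact smul_add (f x) (X x) (Y x)
  add_smul f g X := by ext x; exact add_smul (f x) (g x) (X x)
  zero_smul X := by ext x; exact zero_smul ℝ (X x)

instance : IsScalarTower ℝ (SmoothFn E M) (SmoothVF E M) where
  smul_assoc c f X := by ext x; exact mul_smul c (f x) (X x)

instance : SMulCommClass (SmoothFn E M) ℝ (SmoothVF E M) where
  smul_comm f c X := by ext x; exact smul_comm (f x) c (X x)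

instance : SMulCommClass ℝ (SmoothFn E M) (SmoothVF E M) where
  smul_comm c f X := by ext x; exact smul_comm c (f x) (X x)

theorem mdiff (X : SmoothVF E M) (x : M) :
    MDifferentiableAt 𝓘(ℝ, E) (𝓘(ℝ, E).prod 𝓘(ℝ, E))
      (fun y => (X y : TangentBundle 𝓘(ℝ, E) M)) x :=
  X.contMDiff.mdifferentiable (by simp) x

theorem contMDiff_deriv (X : SmoothVF E M) (f : SmoothFn E M) :
    ContMDiff 𝓘(ℝ, E) 𝓘(ℝ, ℝ) ∞ (fun x => mvfderiv 𝓘(ℝ, E) f x (X x)) := by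
  have h1 : IsManifold 𝓘(ℝ, E) 1 M := IsManifold.of_le (n := ∞) (by simp)
  have h2 := (f.contMDiff.contMDiff_tangentMap (m := ∞) (by simp)).comp X.contMDiff
  exact (contMDiff_snd_tangentBundle_modelSpace ℝ 𝓘(ℝ, ℝ)).comp h2

/-- The action of vector fields on functions, `X ↦ (f ↦ X f)`, where `(X f) x = df_x (X_x)`. -/
def deriv : SmoothVF E M →ₗ[SmoothFn E M] Derivation ℝ (SmoothFn E M) (SmoothFn E M) where
  toFun X := Derivation.mk'
    { toFun f := ⟨fun x => mvfderiv 𝓘(ℝ, E) f x (X x), contMDiff_deriv X f⟩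
      map_add' f g := by
        ext x
        exact congrArg (fun T => T (X x)) (mvfderiv_add (SmoothFn.mdiff f x) (SmoothFn.mdiff g x))
      map_smul' c f := by
        ext x
        have h := mvfderiv_smul (I := 𝓘(ℝ, E)) (a := fun _ : M => c) (x := x)
          mdifferentiableAt_const (SmoothFn.mdiff f x)
        have h2 := congrArg (fun T => T (X x)) h
        rw [mvfderiv_const] at h2
        simpa using! h2 }
    (fun f g => by
      ext x
      have h := congrArg (fun T => T (X x)) (mvfderiv_mul (SmoothFn.mdiff f x) (SmoothFn.mdiff g x))
      simpa using! h)
  map_add' X Y := by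
    ext f x
    exact map_add (mvfderiv 𝓘(ℝ, E) f x) (X x) (Y x)
  map_smul' c X := by
    ext f x
    exact map_smul (mvfderiv 𝓘(ℝ, E) f x) (c x) (X x)

variable [FiniteDimensional ℝ E]

/-- The Lie bracket `[X, Y]` of smooth vector fields. -/
def bracket : SmoothVF E M →ₗ[ℝ] SmoothVF E M →ₗ[ℝ] SmoothVF E M :=
  haveI := FiniteDimensional.complete ℝ E
  haveI : IsManifold 𝓘(ℝ, E) (((⊤ : ℕ∞) : WithTop ℕ∞) + 1) M := ‹IsManifold 𝓘(ℝ, E) ∞ M›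
  haveI : IsManifold 𝓘(ℝ, E) 2 M :=
    IsManifold.of_le (n := ∞) (WithTop.coe_le_coe.2 le_top)
  haveI : IsManifold 𝓘(ℝ, E) (minSmoothness ℝ 2) M := by simpa using this
  LinearMap.mk₂ ℝ
    (fun X Y => ⟨VectorField.mlieBracket 𝓘(ℝ, E) X Y,
      ContDiff.mlieBracket_vectorField (m := ⊤) (n := ⊤) X.contMDiff Y.contMDiff (by simp)⟩)
    (fun X Y Z => by
      ext x; exact VectorField.mlieBracket_add_left (X.mdiff x) (Y.mdiff x))
    (fun c X Y => by
      ext x; exact VectorField.mlieBracket_const_smul_left (X.mdiff x))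
    (fun X Y Z => by
      ext x; exact VectorField.mlieBracket_add_right (Y.mdiff x) (Z.mdiff x))
    (fun c X Y => by
      ext x; exact VectorField.mlieBracket_const_smul_right (Y.mdiff x))

theorem bracket_swap (X Y : SmoothVF E M) : bracket X Y = -bracket Y X := by
  ext x; exact VectorField.mlieBracket_swap_apply

theorem bracket_smul (X Y : SmoothVF E M) (f : SmoothFn E M) :
    bracket X (f • Y) = deriv X f • Y + f • bracket X Y := by
  have := FiniteDimensional.complete ℝ E
  have : IsManifold 𝓘(ℝ, E) 2 M :=
    IsManifold.of_le (n := ∞) (WithTop.coe_le_coe.2 le_top)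
  ext x; exact VectorField.mlieBracket_smul_right (SmoothFn.mdiff f x) (Y.mdiff x)

end SmoothVF
end Calculus

noncomputable section Shuffle

variable {R L N₁ N₂ N₃ : Type*} [CommRing R] [AddCommGroup L] [Module R L]
  [AddCommGroup N₁] [Module R N₁] [AddCommGroup N₂] [Module R N₂] [AddCommGroup N₃] [Module R N₃]

/-- The alternating product of alternating maps with respect to a bilinear map `B` of the values:
the sum over all `(p, q)`-shuffles `s` of
`sign s • B (α (v_{s 1}, …, v_{s p})) (β (v_{s (p+1)}, …, v_{s (p+q)}))`. -/
def shuffleProduct (p q : ℕ) (B : N₁ →ₗ[R] N₂ →ₗ[R] N₃) :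
    L [⋀^Fin p]→ₗ[R] N₁ →ₗ[R] L [⋀^Fin q]→ₗ[R] N₂ →ₗ[R] L [⋀^Fin (p + q)]→ₗ[R] N₃ :=
  TensorProduct.curry <|
    (AlternatingMap.domDomCongrₗ R finSumFinEquiv).toLinearMap ∘ₗ
      LinearMap.compAlternatingMapₗ R (TensorProduct.lift B) ∘ₗ AlternatingMap.domCoprod'

/-- The map `(v₁, …, v_p) ↦ (X ↦ σ (X, v₁, …, v_p))`. -/
def splitFirst (p : ℕ) :
    L [⋀^Fin (p + 1)]→ₗ[R] R →ₗ[R] L [⋀^Fin p]→ₗ[R] Module.Dual R L where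
  toFun σ :=
    { toFun v :=
        { toFun X := σ (Fin.cons X v)
          map_add' X Y := σ.toMultilinearMap.cons_add v X Y
          map_smul' c X := σ.toMultilinearMap.cons_smul v c X }
      map_update_add' v i x y := by
        rename_i inst
        obtain rfl := Subsingleton.elim inst (instDecidableEqFin p)
        ext X
        simp [Fin.cons_update]
      map_update_smul' v i c x := by
        rename_i inst
        obtain rfl := Subsingleton.elim inst (instDecidableEqFin p)
        ext X
        simp [Fin.cons_update]
      map_eq_zero_of_eq' v i j h hij := by
        ext X
        exact σ.map_eq_zero_of_eq (i := i.succ) (j := j.succ) _ (by simpa using h) (by simpa) }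
  map_add' σ τ := by ext v X; simp
  map_smul' c σ := by ext v X; simp

end Shuffle

noncomputable section Koszul

variable {R L : Type*} [CommRing R] [Algebra ℝ R] [AddCommGroup L] [Module R L] [Module ℝ L]
  [IsScalarTower ℝ R L] {p : ℕ}
  (a : L →ₗ[R] Derivation ℝ R R) (b : L →ₗ[ℝ] L →ₗ[ℝ] L)

/-- `(v₁, …, v_p) ↦ X (η (v₁, …, v_p))`, as a function of `X`. -/
def koszulFst (η : L [⋀^Fin p]→ₗ[R] R) : L →ₗ[ℝ] L [⋀^Fin p]→ₗ[ℝ] R where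
  toFun X :=
    { toFun v := a X (η v)
      map_update_add' v i x y := by
        simp
      map_update_smul' v i c x := by
        rw [← algebraMap_smul R c x, η.map_update_smul]
        simp [Algebra.smul_def]
      map_eq_zero_of_eq' v i j h hij := by simp [η.map_eq_zero_of_eq v h hij] }
  map_add' X Y := by ext v; simp
  map_smul' c X := by
    ext v
    change a (c • X) (η v) = c • a X (η v)
    rw [← algebraMap_smul R c X, map_smul]
    simp

/-- `(v₁, …, v_p) ↦ ∑ i, η (v₁, …, [v_i, X], …, v_p)`, as a function of `X`. -/
def koszulSnd (η : L [⋀^Fin p]→ₗ[R] R) : L →ₗ[ℝ] L [⋀^Fin p]→ₗ[ℝ] R where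
  toFun X :=
    { toFun v := ∑ i, η (Function.update v i (b (v i) X))
      map_update_add' v i x y := by
        rename_i inst
        obtain rfl := Subsingleton.elim inst (instDecidableEqFin p)
        rw [← Finset.sum_add_distrib]
        refine Finset.sum_congr rfl fun k _ => ?_
        rcases eq_or_ne k i with rfl | hk
        · simp
        · simp [hk, Function.update_comm hk.symm]
      map_update_smul' v i c x := by
        rename_i inst
        obtain rfl := Subsingleton.elim inst (instDecidableEqFin p)
        rw [Finset.smul_sum]
        refine Finset.sum_congr rfl fun k _ => ?_
        have key : ∀ (w : Fin p → L) (y : L),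
            η (Function.update w i (c • y)) = c • η (Function.update w i y) := by
          intro w y
          rw [← algebraMap_smul R c y, η.map_update_smul, algebraMap_smul]
        rcases eq_or_ne k i with rfl | hk
        · simp [key]
        · simp [hk, Function.update_comm hk.symm, key]
      map_eq_zero_of_eq' v i j h hij := by
        have hsw : Function.update v j (b (v j) X)
            = Function.update v i (b (v i) X) ∘ Equiv.swap i j := by
          ext k
          rcases eq_or_ne k i with rfl | hki
          · simp [hij, hij.symm, h]
          rcases eq_or_ne k j with rfl | hkj
          · simp [h]
          · simp [hki, hkj, Equiv.swap_apply_of_ne_of_ne]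
        rw [Fintype.sum_eq_add i j hij, hsw, η.map_swap _ hij, add_neg_cancel]
        rintro k ⟨hki, hkj⟩
        exact η.map_eq_zero_of_eq _ (by simp [hki.symm, hkj.symm, h]) hij }
  map_add' X Y := by
    ext v
    simp [Finset.sum_add_distrib]
  map_smul' c X := by
    ext v
    simp only [map_smul, AlternatingMap.coe_mk, MultilinearMap.coe_mk, RingHom.id_apply,
      AlternatingMap.smul_apply, Finset.smul_sum]
    refine Finset.sum_congr rfl fun k _ => ?_
    rw [← algebraMap_smul R c (b (v k) X), η.map_update_smul, algebraMap_smul]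

/-- `d η` as an `ℝ`-multilinear alternating map. -/
def koszulAux (η : L [⋀^Fin p]→ₗ[R] R) : L [⋀^Fin (p + 1)]→ₗ[ℝ] R :=
  AlternatingMap.alternatizeUncurryFin (koszulFst a η + (1 / 2 : ℝ) • koszulSnd b η)

theorem koszulAux_apply (η : L [⋀^Fin p]→ₗ[R] R) (v : Fin (p + 1) → L) :
    koszulAux a b η v = ∑ j : Fin (p + 1), (-1) ^ (j : ℕ) • (a (v j) (η (j.removeNth v)) +
      (1 / 2 : ℝ) • ∑ i : Fin p, η (Function.update (j.removeNth v) i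
        (b (v (j.succAbove i)) (v j)))) :=
  AlternatingMap.alternatizeUncurryFin_apply _ _

variable {a b}

theorem koszulAux_cons_smul (hb : ∀ X Y, b X Y = -b Y X)
    (hab : ∀ (X Y : L) (f : R), b X (f • Y) = a X f • Y + f • b X Y)
    (η : L [⋀^Fin p]→ₗ[R] R) (f : R) (X : L) (w : Fin p → L) :
    koszulAux a b η (Fin.cons (f • X) w) = f * koszulAux a b η (Fin.cons X w) := by
  have hab' : ∀ (X Y : L) (f : R), b (f • Y) X = f • b Y X + -(a X f • Y) := by
    intro X Y f
    rw [hb, hab, hb Y X, smul_neg, neg_add, add_comm]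
  rw [koszulAux_apply, koszulAux_apply]
  cases p with
  | zero => simp
  | succ m =>
    have hrem : ∀ (Y : L) (i : Fin (m + 1)),
        (Fin.succ i).removeNth (Fin.cons Y w : Fin (m + 2) → L) = Fin.cons Y (i.removeNth w) := by
      intro Y i
      ext k
      refine Fin.cases ?_ (fun k => ?_) k <;> simp [Fin.removeNth]
    have had : ∀ (Y Z : L) (u : Fin m → L),
        η (Fin.cons (Y + Z) u) = η (Fin.cons Y u) + η (Fin.cons Z u) :=
      fun Y Z u => η.toMultilinearMap.cons_add u Y Z
    have hneg : ∀ (Y : L) (u : Fin m → L), η (Fin.cons (-Y) u) = -η (Fin.cons Y u) := by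
      intro Y u
      have := η.toMultilinearMap.cons_smul u (-1) Y
      simpa using this
    have hsm' : ∀ (g : R) (Y : L) (u : Fin m → L),
        η (Fin.cons (g • Y) u) = g * η (Fin.cons Y u) :=
      fun g Y u => η.toMultilinearMap.cons_smul u g Y
    have hins : ∀ i : Fin (m + 1),
        η (Function.update w i X) = (-1) ^ (i : ℕ) • η (Fin.cons X (i.removeNth w)) := by
      intro i
      rw [← Fin.insertNth_removeNth, η.map_insertNth]
      rfl
    have h0 : ∀ Y : L, (0 : Fin (m + 2)).removeNth (Fin.cons Y w : Fin (m + 2) → L) = w := by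
      intro Y; ext k; simp [Fin.removeNth]
    obtain ⟨h, hh, hh2⟩ : ∃ h : R, (∀ x : R, (1 / 2 : ℝ) • x = h * x) ∧ 2 * h = 1 := by
      refine ⟨algebraMap ℝ R (1 / 2), fun x => Algebra.smul_def _ x, ?_⟩
      rw [← map_ofNat (algebraMap ℝ R) 2, ← map_mul]
      norm_num
    have key : ∀ (Y : L) (c : Fin (m + 2) → L), c = Fin.cons Y w →
        (∑ j : Fin (m + 2), (-1) ^ (j : ℕ) • (a (c j) (η (j.removeNth c)) +
          (1 / 2 : ℝ) • ∑ i : Fin (m + 1),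
            η (Function.update (j.removeNth c) i (b (c (j.succAbove i)) (c j)))))
        = a Y (η w) + ∑ i : Fin (m + 1), (h * η (Function.update w i (b (w i) Y))
          + (-1) ^ ((i : ℕ) + 1) * (a (w i) (η (Fin.cons Y (i.removeNth w)))
            + h * (η (Fin.cons (b Y (w i)) (i.removeNth w)) + ∑ k : Fin m,
                η (Fin.cons Y (Function.update (i.removeNth w) k
                  (b (w (i.succAbove k)) (w i))))))) := by
      rintro Y c rfl
      rw [Fin.sum_univ_succ, Finset.sum_add_distrib, ← Finset.mul_sum, ← add_assoc]
      congr 1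
      · simp only [hh]
        simp [h0]
      · refine Finset.sum_congr rfl fun i _ => ?_
        rw [hrem, Fin.sum_univ_succ]
        simp only [hh]
        simp [Fin.cons_update, mul_add]
    rw [key _ _ rfl, key _ _ rfl, mul_add, Finset.mul_sum, map_smul]
    congr 1
    refine Finset.sum_congr rfl fun i _ => ?_
    simp only [hab, hab', AlternatingMap.map_update_add, AlternatingMap.map_update_smul, hins,
      hsm', had, hneg, Derivation.leibniz, ← Finset.mul_sum, smul_eq_mul, zsmul_eq_mul]
    push_cast
    rw [pow_succ]
    linear_combination ((-1) ^ (i : ℕ) * a (w i) f * η (Fin.cons X (i.removeNth w))) * hh2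

theorem koszulAux_smul (hb : ∀ X Y, b X Y = -b Y X)
    (hab : ∀ (X Y : L) (f : R), b X (f • Y) = a X f • Y + f • b X Y)
    (η : L [⋀^Fin p]→ₗ[R] R) (v : Fin (p + 1) → L) (i : Fin (p + 1)) (f : R) (X : L) :
    koszulAux a b η (Function.update v i (f • X)) =
      f • koszulAux a b η (Function.update v i X) := by
  have h : ∀ Y : L, koszulAux a b η (Function.update v i Y) =
      (-1) ^ (i : ℕ) • koszulAux a b η (Fin.cons Y (i.removeNth v)) := by
    intro Y
    rw [← Fin.insertNth_removeNth, (koszulAux a b η).map_insertNth]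
    rfl
  rw [h, h, koszulAux_cons_smul hb hab, smul_comm, smul_eq_mul]

end Koszul

noncomputable section Forms

variable (E : Type*) [NormedAddCommGroup E] [NormedSpace ℝ E]
  (M : Type*) [TopologicalSpace M] [ChartedSpace E M] [IsManifold 𝓘(ℝ, E) ∞ M]

/-- `Λ^p M`: differential `p`-forms, as alternating `C^∞(M)`-multilinear maps
`𝔛(M) × ⋯ × 𝔛(M) → C^∞(M)`. -/
abbrev DForm (p : ℕ) : Type _ := SmoothVF E M [⋀^Fin p]→ₗ[SmoothFn E M] SmoothFn E M

/-- `Λ^k M ⊗ TM`: vector valued differential `k`-forms, as alternating `C^∞(M)`-multilinear maps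
`𝔛(M) × ⋯ × 𝔛(M) → 𝔛(M)`. -/
abbrev VForm (k : ℕ) : Type _ := SmoothVF E M [⋀^Fin k]→ₗ[SmoothFn E M] SmoothVF E M

/-- `Λ^* M`: the space of all differential forms. -/
abbrev DForms : Type _ := DirectSum ℕ (DForm E M)

instance : AddCommGroup (DForms E M) := inferInstanceAs (AddCommGroup (DirectSum ℕ (DForm E M)))

/-- `End(TM)`, which is identified with `Λ^1 M ⊗ TM`. -/
abbrev EndTM : Type _ := Module.End (SmoothFn E M) (SmoothVF E M)

variable {E M}

/-- An endomorphism of `TM` as an element of `Λ^1 M ⊗ TM`. -/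
def EndTM.toVForm (Φ : EndTM E M) : VForm E M 1 :=
  AlternatingMap.ofSubsingleton (SmoothFn E M) (SmoothVF E M) (SmoothVF E M) (0 : Fin 1) Φ

instance (p : ℕ) : IsScalarTower ℝ (SmoothFn E M) (DForm E M p) where
  smul_assoc c f α := by ext1 v; exact smul_assoc c f (α v)

instance (p : ℕ) : SMulCommClass (SmoothFn E M) ℝ (DForm E M p) where
  smul_comm f c α := by ext1 v; exact smul_comm f c (α v)

/-- The wedge product `Λ^p M × Λ^q M → Λ^{p+q} M`. -/
def wedge (p q : ℕ) : DForm E M p →ₗ[ℝ] DForm E M q →ₗ[ℝ] DForm E M (p + q) :=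
  (shuffleProduct p q (LinearMap.mul (SmoothFn E M) (SmoothFn E M))).restrictScalars₁₂ ℝ ℝ

/-- The wedge product on `Λ^* M`. -/
def wedgeTotal : DForms E M →ₗ[ℝ] DForms E M →ₗ[ℝ] DForms E M :=
  DirectSum.toModule ℝ ℕ _ fun p => LinearMap.flip <| DirectSum.toModule ℝ ℕ _ fun q =>
    LinearMap.flip <| (wedge p q).compr₂ (DirectSum.lof ℝ ℕ (DForm E M) (p + q))


variable [FiniteDimensional ℝ E]

/-- The exterior derivative `d : Λ^p M → Λ^{p+1} M`, by Koszul's formula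
`dη (v₀, …, v_p) = ∑ j, (-1)^j v_j (η (v₀, …, v̂_j, …, v_p))
  + ½ ∑ i ≠ j, (-1)^j η (v₀, …, [v_i, v_j], …, v̂_j, …, v_p)`,
where `[v_i, v_j]` stands in the place of `v_i` (both terms of a pair `{i, j}` are equal). -/
def extDer (p : ℕ) : DForm E M p →ₗ[ℝ] DForm E M (p + 1) where
  toFun η :=
    { toFun v := ∑ j : Fin (p + 1), (-1) ^ (j : ℕ) • (SmoothVF.deriv (v j) (η (j.removeNth v)) +
        (1 / 2 : ℝ) • ∑ i : Fin p, η (Function.update (j.removeNth v) i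
          (SmoothVF.bracket (v (j.succAbove i)) (v j))))
      map_update_add' v i X Y := by
        simp only [← koszulAux_apply]
        exact AlternatingMap.map_update_add _ v i X Y
      map_update_smul' v i f X := by
        rename_i inst
        obtain rfl := Subsingleton.elim inst (instDecidableEqFin (p + 1))
        simp only [← koszulAux_apply]
        exact koszulAux_smul SmoothVF.bracket_swap SmoothVF.bracket_smul η v i f X
      map_eq_zero_of_eq' v i j h hij := by
        simp only [← koszulAux_apply]
        exact AlternatingMap.map_eq_zero_of_eq _ v h hij }
  map_add' η θ := by
    ext1 v
    simp only [AlternatingMap.coe_mk, MultilinearMap.coe_mk, AlternatingMap.add_apply, map_add,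
      Finset.sum_add_distrib, smul_add]
    abel
  map_smul' c η := by
    ext1 v
    simp only [AlternatingMap.coe_mk, MultilinearMap.coe_mk, AlternatingMap.smul_apply,
      RingHom.id_apply, Derivation.map_smul]
    rw [Finset.smul_sum]
    refine Finset.sum_congr rfl fun j _ => ?_
    rw [← Finset.smul_sum, smul_comm (1 / 2 : ℝ) c, ← smul_add c, smul_comm c ((-1 : ℤ) ^ (j : ℕ))]

/-- The exterior derivative on `Λ^* M`. -/
def extDerTotal : Module.End ℝ (DForms E M) :=
  DirectSum.toModule ℝ ℕ _ fun p => DirectSum.lof ℝ ℕ (DForm E M) (p + 1) ∘ₗ extDer p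

/-- `D` is a graded derivation of degree `k` of `Λ^* M`, i.e. `D ∈ 𝒟^k(M)`. -/
def IsGradedDerivation (k : ℤ) (D : Module.End ℝ (DForms E M)) : Prop :=
  (∀ (p : ℕ) (α : DForm E M p) (q : ℕ), (q : ℤ) ≠ p + k →
    D (DirectSum.lof ℝ ℕ (DForm E M) p α) q = 0) ∧
  ∀ (p : ℕ) (α : DForm E M p) (β : DForms E M),
    D (wedgeTotal (DirectSum.lof ℝ ℕ (DForm E M) p α) β) =
      wedgeTotal (D (DirectSum.lof ℝ ℕ (DForm E M) p α)) β +
        (k * p).negOnePow • wedgeTotal (DirectSum.lof ℝ ℕ (DForm E M) p α) (D β)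

/-- The graded commutator `[P, Q] = P Q - (-1)^{k l} Q P` of operators `P`, `Q` of degrees
`k`, `l`. -/
def gradedComm (k l : ℤ) (P Q : Module.End ℝ (DForms E M)) : Module.End ℝ (DForms E M) :=
  P * Q - (k * l).negOnePow • (Q * P)

/-- `ℐ_Φ : Λ^{p+1} M → Λ^{k+p} M` for `Φ ∈ Λ^k M ⊗ TM`: the sum over all `(k, p)`-shuffles `s` of
`sign s * σ (Φ (v_{s 1}, …, v_{s k}), v_{s (k+1)}, …, v_{s (k+p)})`. For `Φ = α ⊗ X` this is
`σ ↦ α ∧ ι_X σ`. -/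
def contraction (k p : ℕ) (Φ : VForm E M k) : DForm E M (p + 1) →ₗ[ℝ] DForm E M (k + p) :=
  (shuffleProduct k p (Module.Dual.eval (SmoothFn E M) (SmoothVF E M)) Φ ∘ₗ
    splitFirst p).restrictScalars ℝ

/-- The operator `ℐ_Φ` on `Λ^* M`; it vanishes on functions. -/
def insertion {k : ℕ} (Φ : VForm E M k) : Module.End ℝ (DForms E M) :=
  DirectSum.toModule ℝ ℕ _ fun p => match p with
    | 0 => 0
    | p + 1 => DirectSum.lof ℝ ℕ (DForm E M) (k + p) ∘ₗ contraction k p Φ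

/-- The operator `ℒ_Φ = [ℐ_Φ, d]` on `Λ^* M`. For `Φ = α ⊗ X` with `α` of degree `k` this is
`σ ↦ α ∧ ℒ_X σ + (-1)^k dα ∧ ι_X σ`, by Cartan's formula `ℒ_X = ι_X d + d ι_X`. -/
def lieDer {k : ℕ} (Φ : VForm E M k) : Module.End ℝ (DForms E M) :=
  gradedComm ((k : ℤ) - 1) 1 (insertion Φ) extDerTotal

/-- The Frölicher-Nijenhuis bracket: the unique form `[Φ, Ψ]` with
`ℒ_{[Φ, Ψ]} = [ℒ_Φ, ℒ_Ψ]`. -/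
def fnBracket {k l : ℕ} (Φ : VForm E M k) (Ψ : VForm E M l) : VForm E M (k + l) :=
  Classical.epsilon fun Θ => lieDer Θ = gradedComm k l (lieDer Φ) (lieDer Ψ)

/-- The map `ℵ` on derivations of degree `k`: `ℵ(D) = (-1)^k ℐ_Φ`, where `D = ℒ_Φ + ℐ_Ψ` is
the unique decomposition of `D` with `Φ ∈ Λ^k M ⊗ TM` and `Ψ ∈ Λ^{k+1} M ⊗ TM`. -/
def aleph (k : ℕ) (D : Module.End ℝ (DForms E M)) : Module.End ℝ (DForms E M) :=
  (-1 : ℝ) ^ k • insertion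
    (Classical.epsilon fun Φ : VForm E M k => ∃ Ψ : VForm E M (k + 1), D = lieDer Φ + insertion Ψ)

/-- The action of an endomorphism of `TM` on `Λ^* M`:
`(R σ)(v₁, …, v_p) = σ (R v₁, …, R v_p)`. -/
def EndTM.onForms (R : EndTM E M) : Module.End ℝ (DForms E M) :=
  DirectSum.toModule ℝ ℕ _ fun p => DirectSum.lof ℝ ℕ (DForm E M) p ∘ₗ
    { toFun σ := σ.compLinearMap R
      map_add' _ _ := rfl
      map_smul' _ _ := rfl }

/-- `e_Φ = R d R⁻¹ - d` with `R = Id + Φ` (for invertible `R`), the canonical solution of the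
Maurer-Cartan equation associated to `Φ`. -/
def canonicalSolution (Φ : EndTM E M) : Module.End ℝ (DForms E M) :=
  EndTM.onForms (1 + Φ) * extDerTotal * EndTM.onForms (Ring.inverse (1 + Φ)) - extDerTotal

/-- `b(Φ) = -½ (Id + Φ)⁻¹ [Φ, Φ]` (for invertible `Id + Φ`). -/
def bForm (Φ : EndTM E M) : VForm E M (1 + 1) :=
  -((1 / 2 : ℝ) • LinearMap.compAlternatingMap (Ring.inverse (1 + Φ))
    (fnBracket Φ.toVForm Φ.toVForm))

/-- The derivations `γ_k`, `k ≥ 1`: `γ_1 = ℒ_Φ` and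
`γ_k = -½ ∑_{p + q = k, p ≥ 1, q ≥ 1} ℵ([γ_p, γ_q])` for `k ≥ 2` (and the dummy value `γ_0 = 0`). -/
def gammaSeq (Φ : EndTM E M) : ℕ → Module.End ℝ (DForms E M)
  | 0 => 0
  | 1 => lieDer Φ.toVForm
  | k + 2 => -((1 / 2 : ℝ) • ∑ p : Fin (k + 1),
      aleph 2 (gradedComm 1 1 (gammaSeq Φ (p + 1)) (gammaSeq Φ (k + 1 - p))))

/-- Pointwise convergence of a sequence of smooth functions. -/
def ConvergesPointwise (F : ℕ → SmoothFn E M) (f : SmoothFn E M) : Prop :=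
  ∀ x : M, Filter.Tendsto (fun N => F N x) Filter.atTop (nhds (f x))

/-- The iterated derivative `X₁ (X₂ (⋯ (X_r f)))` along vector fields. -/
def iteratedLieDeriv : List (SmoothVF E M) → SmoothFn E M → SmoothFn E M
  | [], f => f
  | X :: l, f => SmoothVF.deriv X (iteratedLieDeriv l f)

/-- Convergence of a sequence of smooth functions in the `C^∞` topology: all iterated derivatives
along smooth vector fields converge locally uniformly. -/
def ConvergesSmoothly (F : ℕ → SmoothFn E M) (f : SmoothFn E M) : Prop :=
  ∀ l : List (SmoothVF E M), TendstoLocallyUniformly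
    (fun N x => iteratedLieDeriv l (F N) x) (fun x => iteratedLieDeriv l f x) Filter.atTop

/-- Convergence of a sequence of endomorphisms of `TM`, i.e. of their coefficients `α (A X)` for
`1`-forms `α` and vector fields `X`, with respect to a notion of convergence of functions. -/
def EndTM.Converges (conv : (ℕ → SmoothFn E M) → SmoothFn E M → Prop)
    (A : ℕ → EndTM E M) (B : EndTM E M) : Prop :=
  ∀ (α : Module.Dual (SmoothFn E M) (SmoothVF E M)) (X : SmoothVF E M),
    conv (fun N => α (A N X)) (α (B X))

/-- Convergence of a sequence of operators on `Λ^* M`, i.e. of the coefficients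
`(D σ) (v₁, …, v_q)` for forms `σ` and vector fields `v_i`, with respect to a notion of convergence
of functions. -/
def OperatorConverges (conv : (ℕ → SmoothFn E M) → SmoothFn E M → Prop)
    (A : ℕ → Module.End ℝ (DForms E M)) (B : Module.End ℝ (DForms E M)) : Prop :=
  ∀ (σ : DForms E M) (q : ℕ) (v : Fin q → SmoothVF E M),
    conv (fun N => A N σ q v) (B σ q v)

end Forms

/-! The proof rests on one rigidity fact: a graded derivation of the algebra of forms that kills all
functions is an insertion `ℐ_Θ`, and `Θ` is determined by the values of `ℐ_Θ` on the differentials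
`df`.

Write `L = ℒ_Φ`, `I = ℐ_Φ`, `R = Id + Φ`, and `[Φ, Φ]` for the Frölicher-Nijenhuis bracket. On a
function `f`, both `[I, L]` and `ℒ_{Φ²}` give `df ∘ Φ²`, so their difference is some `ℐ_Θ`;
bracketing with `d` and using `d² = 0` shows `Θ = -[Φ, Φ]`. Likewise `e_Φ - L` kills functions,
because `R df = df + I df`, so it is some `ℐ_b`. Evaluating on `R θ` for a 1-form `θ`, and expanding
the action of `R` on the 2-form `dθ` in terms of `I`, gives half of the previous identity. Hence `R
b = -½ [Φ, Φ]`, that is, `e_Φ = γ_1 + ℐ_{b(Φ)}`.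

The map `ℵ` sees only the `ℒ`-part of a derivation. Here `[L, L] = ℒ_{[Φ, Φ]}`, while `[L, ℐ_Ψ]` is
`ℒ_{ΦΨ}` plus an insertion and `[ℐ, ℐ]` is an insertion. So for `k ≥ 3` only the two extreme terms
of the recursion survive, and each step multiplies by `-Φ`. The partial sums from `k = 2` on are `-½
ℐ_{A[Φ, Φ]}` with `A` a partial sum of the Neumann series. A coefficient of `ℐ_{AΨ} σ` is a finite
signed sum of terms `α (A X)` whose `α` and `X` do not depend on `A`, so the assumed convergence
carries over.

Derivations are handled through their graded commutators with interior products (`TForms.IsDer`). As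
a form is determined by its contractions and its function part, the Jacobi and Leibniz rules and the
rigidity become inductions on degree. The main carriers are `IsDer.commutator`, `IsDer.map_wedge`,
`IsDer.conj`, `IsDer.exists_eq_ins`, `ins_toVForm_lieOp_commutator`, `canonicalSolution_eq`,
`lift_gammaSeq_add_two` and `tendsto_ins`. -/

/-! ### Contraction of shuffle products, with arguments taken from sequences so that `p + q` needs
no casts. -/

section SeqEval

variable {R L N N₁ N₂ N₃ : Type*} [CommRing R] [AddCommGroup L] [Module R L]
  [AddCommGroup N] [Module R N]
  [AddCommGroup N₁] [Module R N₁] [AddCommGroup N₂] [Module R N₂] [AddCommGroup N₃] [Module R N₃]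

/-- The value of an alternating map on the first entries of a sequence. -/
def AlternatingMap.evSeq {p : ℕ} (α : L [⋀^Fin p]→ₗ[R] N) (u : ℕ → L) : N := α fun i => u i

/-- The sequence `X, u 0, u 1, …`. -/
def seqCons {L : Type*} (X : L) (u : ℕ → L) : ℕ → L
  | 0 => X
  | k + 1 => u k

/-- The sequence `u 0, …, u (i - 1), X, u i, …`. -/
def seqInsert {L : Type*} (i : ℕ) (X : L) (u : ℕ → L) (k : ℕ) : L :=
  if k < i then u k else if k = i then X else u (k - 1)

theorem AlternatingMap.evSeq_congr {p : ℕ} (α : L [⋀^Fin p]→ₗ[R] N) {u v : ℕ → L}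
    (h : ∀ k < p, u k = v k) : α.evSeq u = α.evSeq v := by
  unfold evSeq
  congr 1
  ext i
  exact h i i.2

theorem AlternatingMap.evSeq_seqCons {p : ℕ} (α : L [⋀^Fin (p + 1)]→ₗ[R] N) (X : L) (u : ℕ → L) :
    α.evSeq (seqCons X u) = (α.curryLeft X).evSeq u := by
  unfold evSeq
  rw [curryLeft_apply_apply]
  congr 1
  ext i
  refine Fin.cases rfl (fun i => rfl) i

theorem seqInsert_fin {L : Type*} {n : ℕ} (i : Fin (n + 1)) (X : L) (u : ℕ → L) :
    (fun k : Fin (n + 1) => seqInsert i X u k) = i.insertNth X (fun k : Fin n => u k) := by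
  ext k
  refine Fin.succAboveCases i ?_ (fun k => ?_) k
  · simp [seqInsert]
  · rw [Fin.insertNth_apply_succAbove]
    rcases lt_or_ge k.castSucc i with h | h
    · rw [Fin.succAbove_of_castSucc_lt _ _ h]
      have : (k : ℕ) < i := h
      simp [seqInsert, this]
    · rw [Fin.succAbove_of_le_castSucc _ _ h]
      have : (i : ℕ) ≤ k := h
      have h1 : ¬ ((k : ℕ) + 1 < i) := by omega
      have h2 : ¬ ((k : ℕ) + 1 = i) := by omega
      simp [seqInsert, h1, h2]

theorem AlternatingMap.evSeq_seqInsert {p : ℕ} (α : L [⋀^Fin (p + 1)]→ₗ[R] N) {i : ℕ}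
    (hi : i ≤ p) (X : L) (u : ℕ → L) :
    α.evSeq (seqInsert i X u) = (-1 : ℤ) ^ i • (α.curryLeft X).evSeq u := by
  have := seqInsert_fin (n := p) ⟨i, by omega⟩ X u
  unfold evSeq
  dsimp only at this
  rw [this, α.map_insertNth]
  rfl

/-- A permutation of `Fin n` as a map of sequence indices. -/
def permSeq {n : ℕ} (e : Equiv.Perm (Fin n)) (k : ℕ) : ℕ :=
  if h : k < n then e ⟨k, h⟩ else k

/-- A permutation factors uniquely as one fixing `0` after the cycle that moves `i` to `0`, where
`i` is the preimage of `0`. This sorts permutations by the slot that receives the first argument. -/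
theorem Fin.sum_perm_succ {N : Type*} [AddCommGroup N] {n : ℕ}
    (f : Equiv.Perm (Fin (n + 1)) → N) :
    ∑ σ, f σ = ∑ e : Equiv.Perm (Fin n), ∑ i : Fin (n + 1),
      f (Equiv.Perm.decomposeFin.symm (0, e) * i.cycleRange) := by
  rw [← Fintype.sum_prod_type' (f := fun (e : Equiv.Perm (Fin n)) (i : Fin (n + 1)) =>
    f (Equiv.Perm.decomposeFin.symm (0, e) * i.cycleRange))]
  symm
  refine Function.Bijective.sum_comp (g := f) (e := fun x : Equiv.Perm (Fin n) × Fin (n + 1) =>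
    Equiv.Perm.decomposeFin.symm (0, x.1) * x.2.cycleRange) ?_
  rw [Fintype.bijective_iff_injective_and_card]
  constructor
  · rintro ⟨e, i⟩ ⟨e', i'⟩ h
    have h1 : ∀ (e : Equiv.Perm (Fin n)) (i : Fin (n + 1)),
        (Equiv.Perm.decomposeFin.symm (0, e) * i.cycleRange) i = 0 := by
      intro e i; simp
    have hi : i = i' := by
      apply (Equiv.Perm.decomposeFin.symm (0, e') * i'.cycleRange).injective
      rw [h1 e' i']
      have := h1 e i
      dsimp only at h
      rwa [h] at this
    subst hi
    have := mul_right_cancel h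
    have := Equiv.Perm.decomposeFin.symm.injective this
    simpa using this
  · simp [Fintype.card_perm, Nat.factorial_succ, mul_comm]

theorem seqCons_comp_permSeq {L : Type*} {n : ℕ} (X : L) (u : ℕ → L) (e : Equiv.Perm (Fin n))
    (i : Fin (n + 1)) {k : ℕ} (hk : k < n + 1) :
    seqCons X u (permSeq (Equiv.Perm.decomposeFin.symm (0, e) * i.cycleRange) k) =
      seqInsert i X (fun j => u (permSeq e j)) k := by
  have h := congrFun (seqInsert_fin i X (fun j => u (permSeq e j))) ⟨k, hk⟩
  dsimp only at h
  rw [h]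
  generalize hk' : (⟨k, hk⟩ : Fin (n + 1)) = k'
  simp only [permSeq, hk, dif_pos, hk']
  refine Fin.succAboveCases i ?_ (fun j => ?_) k'
  · simp [seqCons]
  · simp [seqCons, Fin.cycleRange_succAbove]

/-- The unsymmetrized product of two alternating maps, on sequences. -/
def seqProduct {p q : ℕ} (B : N₁ →ₗ[R] N₂ →ₗ[R] N₃) (α : L [⋀^Fin p]→ₗ[R] N₁)
    (β : L [⋀^Fin q]→ₗ[R] N₂) (u : ℕ → L) : N₃ :=
  B (α.evSeq u) (β.evSeq fun k => u (p + k))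

theorem seqProduct_congr {p q : ℕ} (B : N₁ →ₗ[R] N₂ →ₗ[R] N₃) (α : L [⋀^Fin p]→ₗ[R] N₁)
    (β : L [⋀^Fin q]→ₗ[R] N₂) {u v : ℕ → L} (h : ∀ k < p + q, u k = v k) :
    seqProduct B α β u = seqProduct B α β v := by
  unfold seqProduct
  rw [α.evSeq_congr (u := u) (v := v) fun k hk => h k (by omega),
    β.evSeq_congr fun k hk => h (p + k) (by omega)]

theorem seqProduct_seqInsert_left {p q : ℕ} (B : N₁ →ₗ[R] N₂ →ₗ[R] N₃)
    (α : L [⋀^Fin (p + 1)]→ₗ[R] N₁) (β : L [⋀^Fin q]→ₗ[R] N₂) (X : L) (u : ℕ → L) {i : ℕ}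
    (hi : i ≤ p) :
    (-1 : ℤ) ^ i • seqProduct B α β (seqInsert i X u) =
      seqProduct B (α.curryLeft X) β u := by
  unfold seqProduct
  rw [α.evSeq_seqInsert hi]
  have : (fun k => seqInsert i X u (p + 1 + k)) = fun k => u (p + k) := by
    ext k
    have h1 : ¬ (p + 1 + k < i) := by omega
    have h2 : ¬ (p + 1 + k = i) := by omega
    simp only [seqInsert, h1, h2, if_false]
    congr 1
    omega
  rw [this, map_zsmul, LinearMap.smul_apply, smul_smul, ← mul_pow]
  simp

theorem seqProduct_seqInsert_right {p q : ℕ} (B : N₁ →ₗ[R] N₂ →ₗ[R] N₃)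
    (α : L [⋀^Fin p]→ₗ[R] N₁) (β : L [⋀^Fin (q + 1)]→ₗ[R] N₂) (X : L) (u : ℕ → L) {j : ℕ}
    (hj : j ≤ q) :
    (-1 : ℤ) ^ (p + j) • seqProduct B α β (seqInsert (p + j) X u) =
      (-1 : ℤ) ^ p • seqProduct B α (β.curryLeft X) u := by
  unfold seqProduct
  have : (fun k => seqInsert (p + j) X u (p + k)) = seqInsert j X fun k => u (p + k) := by
    ext k
    simp only [seqInsert, Nat.add_lt_add_iff_left, Nat.add_left_cancel_iff]
    split_ifs
    · rfl
    · rfl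
    · congr 1
      omega
  rw [this, β.evSeq_seqInsert hj, map_zsmul, smul_smul]
  rw [α.evSeq_congr (u := seqInsert (p + j) X u) (v := u)]
  · rw [pow_add, mul_assoc, ← mul_pow]
    simp
  · intro k hk
    have h1 : k < p + j := by omega
    simp [seqInsert, h1]

/-- Each shuffle stands for a coset of `S_p × S_q`. Multiplying by `p! q!` replaces the sum over
cosets by a sum over all permutations, where the first argument can be tracked. -/
theorem factorial_smul_shuffleProduct {p q : ℕ} (B : N₁ →ₗ[R] N₂ →ₗ[R] N₃)
    (α : L [⋀^Fin p]→ₗ[R] N₁) (β : L [⋀^Fin q]→ₗ[R] N₂) (u : ℕ → L) {n : ℕ} (hn : p + q = n) :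
    (p.factorial * q.factorial) • (shuffleProduct p q B α β).evSeq u =
      ∑ e : Equiv.Perm (Fin n), (Equiv.Perm.sign e : ℤ) •
        seqProduct B α β (fun k => u (permSeq e k)) := by
  subst hn
  have h := MultilinearMap.domCoprod_alternization_eq α β
  rw [Fintype.card_fin, Fintype.card_fin] at h
  have h2 : (p.factorial * q.factorial) • (shuffleProduct p q B α β).evSeq u =
      TensorProduct.lift B (((p.factorial * q.factorial) • α.domCoprod β)
        (fun i => u (finSumFinEquiv i))) := by
    rw [AlternatingMap.smul_apply, map_nsmul]
    rfl
  rw [h2, ← h, MultilinearMap.alternatization_apply, map_sum]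
  refine Fintype.sum_equiv (Equiv.permCongr finSumFinEquiv) _ _ fun σ => ?_
  rw [Equiv.Perm.sign_permCongr]
  have : ∀ (s : ℤˣ) (x : TensorProduct R N₁ N₂),
      TensorProduct.lift B (s • x) = (s : ℤ) • TensorProduct.lift B x := by
    intro s x
    rw [Units.smul_def, map_zsmul]
  rw [this]
  congr 1
  simp only [MultilinearMap.domDomCongr_apply, MultilinearMap.domCoprod_apply,
    AlternatingMap.coe_multilinearMap, TensorProduct.lift.tmul, seqProduct,
    AlternatingMap.evSeq]
  congr 2
  · congr 1
    ext i
    have : (i : ℕ) < p + q := by omega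
    have h3 : finSumFinEquiv.symm (⟨i, this⟩ : Fin (p + q)) = Sum.inl i :=
      finSumFinEquiv_symm_apply_castAdd i
    simp [permSeq, this, h3]
  · ext i
    have : p + (i : ℕ) < p + q := by omega
    have h3 : finSumFinEquiv.symm (⟨p + i, this⟩ : Fin (p + q)) = Sum.inr i :=
      finSumFinEquiv_symm_apply_natAdd i
    simp [permSeq, this, h3]

theorem factorial_smul_shuffleProduct_seqCons {p q : ℕ} (B : N₁ →ₗ[R] N₂ →ₗ[R] N₃)
    (α : L [⋀^Fin p]→ₗ[R] N₁) (β : L [⋀^Fin q]→ₗ[R] N₂) (X : L) (u : ℕ → L) {n : ℕ}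
    (hn : p + q = n + 1) :
    (p.factorial * q.factorial) • (shuffleProduct p q B α β).evSeq (seqCons X u) =
      ∑ e : Equiv.Perm (Fin n), (Equiv.Perm.sign e : ℤ) •
        ((∑ i : Fin p, (-1 : ℤ) ^ (i : ℕ) •
            seqProduct B α β (seqInsert i X (fun k => u (permSeq e k)))) +
          ∑ j : Fin q, (-1 : ℤ) ^ (p + j : ℕ) •
            seqProduct B α β (seqInsert (p + j) X (fun k => u (permSeq e k)))) := by
  rw [factorial_smul_shuffleProduct B α β _ hn, Fin.sum_perm_succ]
  refine Finset.sum_congr rfl fun e _ => ?_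
  have h1 : ∀ i : Fin (n + 1), (Equiv.Perm.sign
      (Equiv.Perm.decomposeFin.symm (0, e) * i.cycleRange) : ℤ) • seqProduct B α β
        (fun k => seqCons X u (permSeq (Equiv.Perm.decomposeFin.symm (0, e) * i.cycleRange) k)) =
      (Equiv.Perm.sign e : ℤ) • (-1 : ℤ) ^ (i : ℕ) •
        seqProduct B α β (seqInsert i X (fun k => u (permSeq e k))) := by
    intro i
    rw [seqProduct_congr B α β fun k hk => seqCons_comp_permSeq X u e i (by omega : k < n + 1),
      smul_smul]
    simp [Fin.sign_cycleRange]
  rw [Finset.sum_congr rfl fun i _ => h1 i, ← Finset.smul_sum]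
  congr 1
  rw [← Fintype.sum_equiv (finCongr hn) (fun i => (-1 : ℤ) ^ (i : ℕ) •
        seqProduct B α β (seqInsert i X (fun k => u (permSeq e k)))) _ (fun i => rfl),
    Fin.sum_univ_add]
  rfl

theorem shuffleProduct_zero_zero (B : N₁ →ₗ[R] N₂ →ₗ[R] N₃)
    (α : L [⋀^Fin 0]→ₗ[R] N₁) (β : L [⋀^Fin 0]→ₗ[R] N₂) (u : ℕ → L) :
    (shuffleProduct 0 0 B α β).evSeq u = B (α.evSeq u) (β.evSeq u) := by
  have := factorial_smul_shuffleProduct B α β u (n := 0) rfl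
  simpa [seqProduct, permSeq] using this

variable [IsAddTorsionFree N₃]

/-- The antiderivation rule of the interior product. `X` lands in one of the `p + 1` slots of `α` or
one of the `q + 1` slots of `β`; with its sign, every slot of the same factor contributes equally,
which supplies the missing factors of the factorials. Factors of degree `0` need separate versions,
since they cannot be contracted. -/
theorem shuffleProduct_seqCons {p q : ℕ} (B : N₁ →ₗ[R] N₂ →ₗ[R] N₃)
    (α : L [⋀^Fin (p + 1)]→ₗ[R] N₁) (β : L [⋀^Fin (q + 1)]→ₗ[R] N₂) (X : L) (u : ℕ → L) :
    (shuffleProduct (p + 1) (q + 1) B α β).evSeq (seqCons X u) =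
      (shuffleProduct p (q + 1) B (α.curryLeft X) β).evSeq u +
        (-1 : ℤ) ^ (p + 1) • (shuffleProduct (p + 1) q B α (β.curryLeft X)).evSeq u := by
  -- Torsion-freeness of `N₃` replaces division by the factorials.
  apply nsmul_right_injective (n := (p + 1).factorial * (q + 1).factorial) (by positivity)
  beta_reduce
  rw [factorial_smul_shuffleProduct_seqCons B α β X u (n := p + q + 1) (by omega), smul_add]
  have h1 := congrArg (fun x => (p + 1) • x) (factorial_smul_shuffleProduct B (α.curryLeft X) β u
    (n := p + q + 1) (by omega))
  have h2 := congrArg (fun x => (q + 1) • (-1 : ℤ) ^ (p + 1) • x)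
    (factorial_smul_shuffleProduct B α (β.curryLeft X) u (n := p + q + 1) (by omega))
  rw [smul_smul, ← mul_assoc, ← Nat.factorial_succ] at h1
  rw [smul_comm ((-1 : ℤ) ^ (p + 1)), smul_smul, mul_left_comm, ← Nat.factorial_succ] at h2
  rw [h1, h2, Finset.smul_sum, Finset.smul_sum, Finset.smul_sum, ← Finset.sum_add_distrib]
  refine Finset.sum_congr rfl fun e _ => ?_
  rw [Finset.sum_congr rfl fun i _ => seqProduct_seqInsert_left B α β X _
      (Nat.lt_succ_iff.1 (Fin.is_lt i)),
    Finset.sum_congr rfl fun j _ => seqProduct_seqInsert_right B α β X _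
      (Nat.lt_succ_iff.1 (Fin.is_lt j))]
  simp only [Finset.sum_const, Finset.card_univ, Fintype.card_fin, smul_add]
  rw [smul_comm (Equiv.Perm.sign e : ℤ), smul_comm (Equiv.Perm.sign e : ℤ),
    smul_comm (Equiv.Perm.sign e : ℤ)]

theorem shuffleProduct_seqCons_zero_right {p : ℕ} (B : N₁ →ₗ[R] N₂ →ₗ[R] N₃)
    (α : L [⋀^Fin (p + 1)]→ₗ[R] N₁) (β : L [⋀^Fin 0]→ₗ[R] N₂) (X : L) (u : ℕ → L) :
    (shuffleProduct (p + 1) 0 B α β).evSeq (seqCons X u) =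
      (shuffleProduct p 0 B (α.curryLeft X) β).evSeq u := by
  apply nsmul_right_injective (n := (p + 1).factorial * (0).factorial) (by positivity)
  beta_reduce
  rw [factorial_smul_shuffleProduct_seqCons B α β X u (n := p) (by omega)]
  have h1 := congrArg (fun x => (p + 1) • x) (factorial_smul_shuffleProduct B (α.curryLeft X) β u
    (n := p) (by omega))
  rw [smul_smul, ← mul_assoc, ← Nat.factorial_succ] at h1
  rw [h1, Finset.smul_sum]
  refine Finset.sum_congr rfl fun e _ => ?_
  rw [Finset.sum_congr rfl fun i _ => seqProduct_seqInsert_left B α β X _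
      (Nat.lt_succ_iff.1 (Fin.is_lt i))]
  simp only [Finset.sum_const, Finset.card_univ, Fintype.card_fin,
    Finset.univ_eq_empty, Finset.sum_empty, add_zero]
  rw [smul_comm (Equiv.Perm.sign e : ℤ)]

theorem shuffleProduct_seqCons_zero_left {q : ℕ} (B : N₁ →ₗ[R] N₂ →ₗ[R] N₃)
    (α : L [⋀^Fin 0]→ₗ[R] N₁) (β : L [⋀^Fin (q + 1)]→ₗ[R] N₂) (X : L) (u : ℕ → L) :
    (shuffleProduct 0 (q + 1) B α β).evSeq (seqCons X u) =
      (shuffleProduct 0 q B α (β.curryLeft X)).evSeq u := by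
  apply nsmul_right_injective (n := (0).factorial * (q + 1).factorial) (by positivity)
  beta_reduce
  rw [factorial_smul_shuffleProduct_seqCons B α β X u (n := q) (by omega)]
  have h2 := congrArg (fun x => (q + 1) • x)
    (factorial_smul_shuffleProduct B α (β.curryLeft X) u (n := q) (by omega))
  rw [smul_smul, mul_left_comm, ← Nat.factorial_succ] at h2
  rw [h2, Finset.smul_sum]
  refine Finset.sum_congr rfl fun e _ => ?_
  rw [Finset.sum_congr rfl fun j _ => seqProduct_seqInsert_right B α β X _
      (Nat.lt_succ_iff.1 (Fin.is_lt j))]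
  simp only [Finset.sum_const, Finset.card_univ, Fintype.card_fin,
    Finset.univ_eq_empty, Finset.sum_empty, zero_add, pow_zero, one_smul]
  rw [smul_comm (Equiv.Perm.sign e : ℤ)]

theorem shuffleProduct_zero_right {p : ℕ} (B : N₁ →ₗ[R] N₂ →ₗ[R] N₃)
    (α : L [⋀^Fin p]→ₗ[R] N₁) (β : L [⋀^Fin 0]→ₗ[R] N₂) (u : ℕ → L) :
    (shuffleProduct p 0 B α β).evSeq u = B (α.evSeq u) (β.evSeq u) := by
  induction p generalizing u with
  | zero => exact shuffleProduct_zero_zero B α β u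
  | succ p ih =>
    obtain ⟨X, u, rfl⟩ : ∃ X v, u = seqCons X v :=
      ⟨u 0, fun k => u (k + 1), funext fun k => by cases k <;> rfl⟩
    rw [shuffleProduct_seqCons_zero_right, ih, α.evSeq_seqCons]
    congr 1
    exact β.evSeq_congr (by simp)

end SeqEval

/-! ### Interior products, wedge products and insertions on the total space of forms. -/

noncomputable section TotalForms

variable {E : Type*} [NormedAddCommGroup E] [NormedSpace ℝ E]
  {M : Type*} [TopologicalSpace M] [ChartedSpace E M] [IsManifold 𝓘(ℝ, E) ∞ M]

instance : IsAddTorsionFree (SmoothFn E M)  where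
  nsmul_right_injective n hn f g h := by
    ext x
    have hx : n • f x = n • g x := congrArg (fun f : SmoothFn E M => f x) h
    exact nsmul_right_injective hn hx

theorem exists_seqCons {L : Type*} (u : ℕ → L) : ∃ X v, u = seqCons X v :=
  ⟨u 0, fun k => u (k + 1), funext fun k => by cases k <;> rfl⟩

theorem AlternatingMap.ext_evSeq {R L N : Type*} [CommRing R] [AddCommGroup L] [Module R L]
    [AddCommGroup N] [Module R N] {p : ℕ} {α β : L [⋀^Fin p]→ₗ[R] N}
    (h : ∀ u, α.evSeq u = β.evSeq u) : α = β := by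
  ext v
  have := h fun k => if h : k < p then v ⟨k, h⟩ else 0
  simpa [evSeq] using this

namespace DForms

local notation "lofD" => DirectSum.lof ℝ ℕ (DForm E M)

theorem ext_evSeq {w w' : DForms E M} (h : ∀ n u, (w n).evSeq u = (w' n).evSeq u) : w = w' :=
  DFinsupp.ext fun n => AlternatingMap.ext_evSeq (h n)

theorem lof_evSeq {p : ℕ} (α : DForm E M p) (n : ℕ) (u : ℕ → SmoothVF E M) :
    (lofD p α n).evSeq u = if p = n then α.evSeq u else 0 := by
  split_ifs with h
  · subst h
    rw [DirectSum.lof_apply]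
  · rw [DirectSum.lof_eq_of, DirectSum.of_eq_of_ne _ _ _ (Ne.symm h)]
    rfl

theorem lof_congr {p q : ℕ} {α : DForm E M p} {β : DForm E M q} (h : p = q)
    (h2 : ∀ u, α.evSeq u = β.evSeq u) : lofD p α = lofD q β := by
  subst h
  rw [AlternatingMap.ext_evSeq h2]

theorem add_evSeq (w w' : DForms E M) (n : ℕ) (u : ℕ → SmoothVF E M) :
    ((w + w') n).evSeq u = (w n).evSeq u + (w' n).evSeq u := rfl

theorem smul_evSeq (c : ℝ) (w : DForms E M) (n : ℕ) (u : ℕ → SmoothVF E M) :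
    ((c • w) n).evSeq u = c • (w n).evSeq u := rfl

/-- Operators on `Λ^* M` agree if they agree on homogeneous forms. -/
theorem end_ext {P Q : Module.End ℝ (DForms E M)}
    (h : ∀ p (α : DForm E M p), P (lofD p α) = Q (lofD p α)) : P = Q :=
  DirectSum.linearMap_ext ℝ fun p => LinearMap.ext (h p)

/-- The interior product `ι_X` on `Λ^* M`. -/
def iota (X : SmoothVF E M) : Module.End ℝ (DForms E M) :=
  DirectSum.toModule ℝ ℕ _ fun p => match p with
    | 0 => 0
    | p + 1 => DirectSum.lof ℝ ℕ (DForm E M) p ∘ₗ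
      { toFun σ := σ.curryLeft X
        map_add' _ _ := rfl
        map_smul' _ _ := rfl }

theorem iota_lof_zero (X : SmoothVF E M) (f : DForm E M 0) : iota X (lofD 0 f) = 0 := by
  simp [iota]

theorem iota_lof_succ (X : SmoothVF E M) {p : ℕ} (σ : DForm E M (p + 1)) :
    iota X (lofD (p + 1) σ) = lofD p (σ.curryLeft X) := by
  rw [iota, DirectSum.toModule_lof]
  rfl

theorem iota_evSeq (X : SmoothVF E M) (w : DForms E M) (n : ℕ) (u : ℕ → SmoothVF E M) :
    (iota X w n).evSeq u = (w (n + 1)).evSeq (seqCons X u) := by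
  induction w using DirectSum.induction_on with
  | zero => simp [AlternatingMap.evSeq]
  | add x y hx hy => rw [map_add, add_evSeq, add_evSeq, hx, hy]
  | of p α =>
    rw [← DirectSum.lof_eq_of ℝ]
    cases p with
    | zero => rw [iota_lof_zero, lof_evSeq]; simp [AlternatingMap.evSeq]
    | succ p => rw [iota_lof_succ, lof_evSeq, lof_evSeq, AlternatingMap.evSeq_seqCons]; simp

/-- Contractions see everything in positive degree, so only the function part is left to compare.
This drives the inductions on degree below. -/
theorem eq_of_iota {w w' : DForms E M} (h : ∀ X, iota X w = iota X w') (h0 : w 0 = w' 0) :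
    w = w' := by
  refine ext_evSeq fun n u => ?_
  cases n with
  | zero => rw [h0]
  | succ n =>
    obtain ⟨X, u, rfl⟩ := exists_seqCons u
    rw [← iota_evSeq, ← iota_evSeq, h]

theorem iota_add (X Y : SmoothVF E M) : iota (X + Y) = iota X + iota Y := by
  refine end_ext fun p α => ?_
  cases p with
  | zero => simp [iota_lof_zero]
  | succ p => simp [iota_lof_succ]

theorem iota_smul (c : ℝ) (X : SmoothVF E M) : iota (c • X) = c • iota X := by
  refine end_ext fun p α => ?_
  cases p with
  | zero => simp [iota_lof_zero]
  | succ p =>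
    rw [LinearMap.smul_apply, iota_lof_succ, iota_lof_succ, ← map_smul,
      ← algebraMap_smul (SmoothFn E M) c X, map_smul, algebraMap_smul]

theorem iota_mul_self (X : SmoothVF E M) : iota X * iota X = 0 := by
  refine end_ext fun p α => ?_
  rcases p with _ | _ | p
  · simp [iota_lof_zero]
  · simp [iota_lof_zero, iota_lof_succ]
  · simp [iota_lof_succ]

theorem iota_mul_iota (X Y : SmoothVF E M) : iota X * iota Y = -(iota Y * iota X) := by
  have h := iota_mul_self (X + Y)
  rw [iota_add, add_mul, mul_add, mul_add, iota_mul_self, iota_mul_self] at h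
  rw [eq_neg_iff_add_eq_zero]
  simpa [add_comm] using h

section Shuffle

variable {N₁ N₂ : Type*} [AddCommGroup N₁] [Module (SmoothFn E M) N₁] [AddCommGroup N₂]
  [Module (SmoothFn E M) N₂] (B : N₁ →ₗ[SmoothFn E M] N₂ →ₗ[SmoothFn E M] SmoothFn E M)
  {p q : ℕ} (X : SmoothVF E M)

theorem iota_lof_shuffle (α : SmoothVF E M [⋀^Fin (p + 1)]→ₗ[SmoothFn E M] N₁)
    (β : SmoothVF E M [⋀^Fin (q + 1)]→ₗ[SmoothFn E M] N₂) :
    iota X (lofD (p + 1 + (q + 1)) (shuffleProduct (p + 1) (q + 1) B α β)) =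
      lofD (p + (q + 1)) (shuffleProduct p (q + 1) B (α.curryLeft X) β) +
        (-1 : ℝ) ^ (p + 1) • lofD (p + 1 + q)
          (shuffleProduct (p + 1) q B α (β.curryLeft X)) := by
  refine ext_evSeq fun n u => ?_
  rw [iota_evSeq, add_evSeq, smul_evSeq, lof_evSeq, lof_evSeq, lof_evSeq]
  by_cases h : p + 1 + q = n
  · rw [if_pos (by omega), if_pos (by omega), if_pos h, shuffleProduct_seqCons]
    congr 1
    rw [← Int.cast_smul_eq_zsmul ℝ]
    simp
  · rw [if_neg (by omega), if_neg (by omega), if_neg h]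
    simp

theorem iota_lof_shuffle_zero_right (α : SmoothVF E M [⋀^Fin (p + 1)]→ₗ[SmoothFn E M] N₁)
    (β : SmoothVF E M [⋀^Fin 0]→ₗ[SmoothFn E M] N₂) :
    iota X (lofD (p + 1 + 0) (shuffleProduct (p + 1) 0 B α β)) =
      lofD (p + 0) (shuffleProduct p 0 B (α.curryLeft X) β) := by
  refine ext_evSeq fun n u => ?_
  rw [iota_evSeq, lof_evSeq, lof_evSeq, shuffleProduct_seqCons_zero_right]
  simp

theorem iota_lof_shuffle_zero_left (α : SmoothVF E M [⋀^Fin 0]→ₗ[SmoothFn E M] N₁)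
    (β : SmoothVF E M [⋀^Fin (q + 1)]→ₗ[SmoothFn E M] N₂) :
    iota X (lofD (0 + (q + 1)) (shuffleProduct 0 (q + 1) B α β)) =
      lofD (0 + q) (shuffleProduct 0 q B α (β.curryLeft X)) := by
  refine ext_evSeq fun n u => ?_
  rw [iota_evSeq, lof_evSeq, lof_evSeq, shuffleProduct_seqCons_zero_left]
  congr 1
  simp only [eq_iff_iff]
  omega

end Shuffle

theorem wedgeTotal_lof {p q : ℕ} (α : DForm E M p) (β : DForm E M q) :
    wedgeTotal (lofD p α) (lofD q β) = lofD (p + q) (wedge p q α β) := by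
  simp [wedgeTotal]

theorem iota_wedgeTotal (X : SmoothVF E M) {p : ℕ} (α : DForm E M p) (β : DForms E M) :
    iota X (wedgeTotal (lofD p α) β) = wedgeTotal (iota X (lofD p α)) β +
      (-1 : ℝ) ^ p • wedgeTotal (lofD p α) (iota X β) := by
  induction β using DirectSum.induction_on with
  | zero => simp
  | add x y hx hy => simp only [map_add, hx, hy, smul_add]; abel
  | of q β =>
    rw [← DirectSum.lof_eq_of ℝ, wedgeTotal_lof]
    rcases p with _ | p <;> rcases q with _ | q
    · rw [iota_lof_zero X α, iota_lof_zero X β, map_zero, map_zero, LinearMap.zero_apply,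
        smul_zero]
      exact (iota_lof_zero X (wedge 0 0 α β)).trans (add_zero _).symm
    · rw [iota_lof_zero, iota_lof_succ X β, map_zero, LinearMap.zero_apply, zero_add ((_ : ℝ) • _),
        pow_zero, one_smul, wedgeTotal_lof]
      exact iota_lof_shuffle_zero_left _ X α β
    · rw [iota_lof_zero X β, iota_lof_succ X α, map_zero, smul_zero,
        wedgeTotal_lof]
      exact (iota_lof_shuffle_zero_right _ X α β).trans (add_zero _).symm
    · rw [iota_lof_succ X α, iota_lof_succ X β, wedgeTotal_lof, wedgeTotal_lof]
      exact iota_lof_shuffle _ X α β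

theorem insertion_lof_zero {k : ℕ} (Ψ : VForm E M k) (f : DForm E M 0) :
    insertion Ψ (lofD 0 f) = 0 := by
  simp [insertion]

theorem insertion_lof_succ {k p : ℕ} (Ψ : VForm E M k) (σ : DForm E M (p + 1)) :
    insertion Ψ (lofD (p + 1) σ) = lofD (k + p) (contraction k p Ψ σ) := by
  simp [insertion]

/-- The two operations fill the first two slots in opposite orders, hence the sign. -/
theorem splitFirst_curryLeft {p : ℕ} (σ : DForm E M (p + 2)) (X : SmoothVF E M) :
    (splitFirst (p + 1) σ).curryLeft X = -splitFirst p (σ.curryLeft X) := by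
  ext1 v
  refine LinearMap.ext fun Y => ?_
  change σ (Fin.cons Y (Fin.cons X v)) = -σ (Fin.cons X (Fin.cons Y v))
  rw [← σ.map_swap _ (i := 0) (j := 1) (by simp)]
  congr 1
  ext i : 1
  refine Fin.cases ?_ (fun i => Fin.cases ?_ (fun i => ?_) i) i
  · simp
  · simp
  · have h1 : (i.succ.succ : Fin (p + 2)) ≠ 0 := Fin.succ_ne_zero _
    have h2 : (i.succ.succ : Fin (p + 2)) ≠ 1 := by
      intro h
      have := congrArg Fin.val h
      simp at this
    simp [Equiv.swap_apply_of_ne_of_ne h1 h2]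

theorem shuffleProduct_splitFirst_curryLeft {k p : ℕ} (Ψ : VForm E M k) (σ : DForm E M (p + 2))
    (X : SmoothVF E M) :
    shuffleProduct k p (Module.Dual.eval (SmoothFn E M) (SmoothVF E M)) Ψ
      ((splitFirst (p + 1) σ).curryLeft X) = -contraction k p Ψ (σ.curryLeft X) := by
  rw [splitFirst_curryLeft]
  exact map_neg (shuffleProduct k p (Module.Dual.eval (SmoothFn E M) (SmoothVF E M)) Ψ) _

theorem iota_insertion {k : ℕ} (Ψ : VForm E M (k + 1)) (X : SmoothVF E M) :
    iota X * insertion Ψ = insertion (Ψ.curryLeft X) + (-1 : ℝ) ^ k • (insertion Ψ * iota X) := by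
  refine end_ext fun p σ => ?_
  simp only [Module.End.mul_apply, LinearMap.add_apply, LinearMap.smul_apply]
  rcases p with _ | _ | p
  · simp [insertion_lof_zero, iota_lof_zero]
  · rw [insertion_lof_succ, insertion_lof_succ, iota_lof_succ X σ, insertion_lof_zero, smul_zero,
      add_zero (lofD _ _)]
    exact iota_lof_shuffle_zero_right _ X Ψ _
  · rw [insertion_lof_succ, insertion_lof_succ, iota_lof_succ X σ, insertion_lof_succ]
    refine (iota_lof_shuffle _ X Ψ _).trans ?_
    -- Moving `X` past `Ψ` costs `(-1)^(k+1)`; the sign of `splitFirst_curryLeft` turns this into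
    -- `(-1)^k`.
    rw [shuffleProduct_splitFirst_curryLeft, LinearMap.map_neg, pow_succ, smul_neg, ← neg_smul,
      mul_neg_one, neg_neg]
    rfl

theorem iota_insertion_zero (Ψ : VForm E M 0) (X : SmoothVF E M) :
    iota X * insertion Ψ = -(insertion Ψ * iota X) := by
  refine end_ext fun p σ => ?_
  simp only [Module.End.mul_apply, LinearMap.neg_apply]
  rcases p with _ | _ | p
  · simp [insertion_lof_zero, iota_lof_zero]
  · rw [insertion_lof_succ, iota_lof_succ X σ, insertion_lof_zero, neg_zero]
    exact iota_lof_zero X _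
  · rw [insertion_lof_succ, iota_lof_succ X σ, insertion_lof_succ]
    refine (iota_lof_shuffle_zero_left _ X Ψ _).trans ?_
    rw [shuffleProduct_splitFirst_curryLeft, LinearMap.map_neg]

/-- A `1`-form, as an element of `Λ^* M`. -/
def ofDual : Module.Dual (SmoothFn E M) (SmoothVF E M) →ₗ[ℝ] DForms E M where
  toFun θ := lofD 1 (AlternatingMap.ofSubsingleton (SmoothFn E M) (SmoothVF E M) (SmoothFn E M)
    (0 : Fin 1) θ)
  map_add' θ η := by
    rw [← map_add]
    rfl
  map_smul' c θ := by
    rw [RingHom.id_apply, ← map_smul]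
    rfl

theorem exists_ofDual (α : DForm E M 1) : ∃ θ, lofD 1 α = ofDual θ :=
  ⟨(AlternatingMap.ofSubsingleton (SmoothFn E M) (SmoothVF E M) (SmoothFn E M)
    (0 : Fin 1)).symm α, by simp [ofDual]⟩

theorem ofDual_evSeq (θ : Module.Dual (SmoothFn E M) (SmoothVF E M)) (u : ℕ → SmoothVF E M) :
    (ofDual θ 1).evSeq u = θ (u 0) := by
  rw [ofDual, LinearMap.coe_mk, AddHom.coe_mk, lof_evSeq]
  simp [AlternatingMap.evSeq]

theorem insertion_ofDual {k : ℕ} (Ψ : VForm E M k)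
    (θ : Module.Dual (SmoothFn E M) (SmoothVF E M)) :
    insertion Ψ (ofDual θ) = lofD k (θ.compAlternatingMap Ψ) := by
  refine (insertion_lof_succ Ψ _).trans (lof_congr (add_zero k) fun u => ?_)
  refine (shuffleProduct_zero_right _ Ψ _ u).trans ?_
  simp [AlternatingMap.evSeq, splitFirst]

/-- Both operators anticommute with every `iota X`, so induction on the degree of the form reduces
the claim to 1-forms, where the function part is nontrivial. -/
theorem insertion_constOfIsEmpty (Y : SmoothVF E M) :
    insertion (AlternatingMap.constOfIsEmpty (SmoothFn E M) (SmoothVF E M) (Fin 0) Y) = iota Y := by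
  refine end_ext fun p => ?_
  induction p with
  | zero => intro f; rw [insertion_lof_zero, iota_lof_zero]
  | succ p ih =>
    intro σ
    refine eq_of_iota (fun X => ?_) ?_
    · have h1 := LinearMap.congr_fun (iota_insertion_zero
        (AlternatingMap.constOfIsEmpty (SmoothFn E M) (SmoothVF E M) (Fin 0) Y) X) (lofD (p + 1) σ)
      have h2 := LinearMap.congr_fun (iota_mul_iota X Y) (lofD (p + 1) σ)
      simp only [Module.End.mul_apply, LinearMap.neg_apply] at h1 h2
      rw [h1, h2, iota_lof_succ, ih]
    · cases p with
      | zero =>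
        obtain ⟨θ, hθ⟩ := exists_ofDual σ
        rw [iota_lof_succ, hθ, insertion_ofDual, DirectSum.lof_apply, DirectSum.lof_apply]
        refine AlternatingMap.ext_evSeq fun u => ?_
        have := ofDual_evSeq θ (seqCons Y u)
        rw [← hθ, DirectSum.lof_apply, AlternatingMap.evSeq_seqCons] at this
        rw [this]
        rfl
      | succ p =>
        refine AlternatingMap.ext_evSeq fun u => ?_
        rw [insertion_lof_succ, iota_lof_succ, lof_evSeq, lof_evSeq, if_neg (by omega),
          if_neg (by omega)]

theorem insertion_add {k : ℕ} (Ψ Ψ' : VForm E M k) :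
    insertion (Ψ + Ψ') = insertion Ψ + insertion Ψ' := by
  refine end_ext fun p σ => ?_
  rw [LinearMap.add_apply]
  cases p with
  | zero => simp [insertion_lof_zero]
  | succ p =>
    rw [insertion_lof_succ, insertion_lof_succ, insertion_lof_succ, ← map_add]
    congr 1
    simp only [contraction, LinearMap.coe_restrictScalars, LinearMap.comp_apply]
    rw [map_add, LinearMap.add_apply]

theorem insertion_smul {k : ℕ} (c : ℝ) (Ψ : VForm E M k) :
    insertion (c • Ψ) = c • insertion Ψ := by
  refine end_ext fun p σ => ?_
  rw [LinearMap.smul_apply]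
  cases p with
  | zero => simp [insertion_lof_zero]
  | succ p =>
    rw [insertion_lof_succ, insertion_lof_succ, ← map_smul]
    congr 1
    have : c • Ψ = algebraMap ℝ (SmoothFn E M) c • Ψ := by
      ext1 v
      exact (algebraMap_smul _ _ _).symm
    simp only [contraction, LinearMap.coe_restrictScalars, LinearMap.comp_apply]
    rw [this, map_smul, LinearMap.smul_apply, algebraMap_smul]

end DForms

end TotalForms

/-! ### Graded derivations, characterized by commutators with interior products. -/

noncomputable section Derivations

variable {E : Type*} [NormedAddCommGroup E] [NormedSpace ℝ E]
  {M : Type*} [TopologicalSpace M] [ChartedSpace E M] [IsManifold 𝓘(ℝ, E) ∞ M]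

variable (E M) in
/-- A copy of the space `Λ^* M`, as a real vector space. -/
def TForms : Type _ := DForms E M

instance : AddCommGroup (TForms E M) := inferInstanceAs (AddCommGroup (DForms E M))

instance : Module ℝ (TForms E M) where
  smul c w := (c • (show DForms E M from w) : DForms E M)
  one_smul w := one_smul ℝ (show DForms E M from w)
  mul_smul c c' w := mul_smul c c' (show DForms E M from w)
  smul_zero c := smul_zero (A := DForms E M) c
  smul_add c w w' := smul_add c (show DForms E M from w) (show DForms E M from w')
  add_smul c c' w := add_smul c c' (show DForms E M from w)
  zero_smul w := zero_smul ℝ (show DForms E M from w)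

namespace TForms

/-- A homogeneous form as an element of `Λ^* M`. -/
def of (p : ℕ) : DForm E M p →ₗ[ℝ] TForms E M where
  toFun α := DirectSum.lof ℝ ℕ (DForm E M) p α
  map_add' α β := map_add (DirectSum.lof ℝ ℕ (DForm E M) p) α β
  map_smul' c α := map_smul (DirectSum.lof ℝ ℕ (DForm E M) p) c α

/-- The homogeneous components of an element of `Λ^* M`. -/
def comp (p : ℕ) : TForms E M →ₗ[ℝ] DForm E M p where
  toFun w := (show DForms E M from w) p
  map_add' _ _ := rfl
  map_smul' _ _ := rfl

/-- Operators on the two copies of `Λ^* M`. -/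
def lift (P : Module.End ℝ (DForms E M)) : Module.End ℝ (TForms E M) where
  toFun w := P w
  map_add' w w' := P.map_add w w'
  map_smul' c w := P.map_smul c w

theorem lift_injective : Function.Injective (lift : Module.End ℝ (DForms E M) → _) := by
  intro P Q h
  exact LinearMap.ext fun w => LinearMap.congr_fun h w

theorem lift_add (P Q : Module.End ℝ (DForms E M)) : lift (P + Q) = lift P + lift Q := rfl

theorem lift_sub (P Q : Module.End ℝ (DForms E M)) : lift (P - Q) = lift P - lift Q := rfl

theorem lift_neg (P : Module.End ℝ (DForms E M)) : lift (-P) = -lift P := rfl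

theorem lift_smul (c : ℝ) (P : Module.End ℝ (DForms E M)) : lift (c • P) = c • lift P := rfl

theorem lift_mul (P Q : Module.End ℝ (DForms E M)) : lift (P * Q) = lift P * lift Q := rfl

theorem lift_zero : lift (0 : Module.End ℝ (DForms E M)) = 0 := rfl

/-- The wedge product on `Λ^* M`. -/
def wedge : TForms E M →ₗ[ℝ] TForms E M →ₗ[ℝ] TForms E M :=
  LinearMap.mk₂ ℝ (fun w w' => (wedgeTotal w w' : DForms E M))
    (fun w w' w'' => LinearMap.map_add₂ wedgeTotal w w' w'')
    (fun c w w' => LinearMap.map_smul₂ wedgeTotal c w w')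
    (fun w w' w'' => (wedgeTotal (show DForms E M from w)).map_add w' w'')
    (fun c w w' => (wedgeTotal (show DForms E M from w)).map_smul c w')

/-- The interior product. -/
def iota : SmoothVF E M →ₗ[ℝ] Module.End ℝ (TForms E M) where
  toFun X := lift (DForms.iota X)
  map_add' X Y := congrArg lift (DForms.iota_add X Y)
  map_smul' c X := congrArg lift (DForms.iota_smul c X)

/-- The insertion operator `ℐ_Ψ`. -/
def ins {k : ℕ} : VForm E M k →ₗ[ℝ] Module.End ℝ (TForms E M) where
  toFun Ψ := lift (insertion Ψ)
  map_add' Ψ Ψ' := congrArg lift (DForms.insertion_add Ψ Ψ')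
  map_smul' c Ψ := congrArg lift (DForms.insertion_smul c Ψ)

/-- A `1`-form as an element of `Λ^* M`. -/
def ofDual : Module.Dual (SmoothFn E M) (SmoothVF E M) →ₗ[ℝ] TForms E M where
  toFun θ := DForms.ofDual θ
  map_add' θ η := map_add DForms.ofDual θ η
  map_smul' c θ := map_smul DForms.ofDual c θ

/-- The action of an endomorphism of `TM` on forms. -/
def act (R : EndTM E M) : Module.End ℝ (TForms E M) := lift R.onForms

theorem comp_of (p : ℕ) (α : DForm E M p) : comp p (of p α) = α :=
  DirectSum.lof_apply ℝ p α

theorem comp_of_ne {p q : ℕ} (h : q ≠ p) (α : DForm E M p) : comp q (of p α) = 0 :=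
  DirectSum.of_eq_of_ne _ _ _ h

theorem of_injective (p : ℕ) : Function.Injective (of p : DForm E M p → TForms E M) :=
  fun α β h => by rw [← comp_of p α, h, comp_of]

theorem ext_comp {w w' : TForms E M} (h : ∀ p, comp p w = comp p w') : w = w' :=
  DFinsupp.ext h

theorem end_ext {P Q : Module.End ℝ (TForms E M)} (h : ∀ p α, P (of p α) = Q (of p α)) : P = Q :=
  LinearMap.ext fun w => by
    induction w using DirectSum.induction_on with
    | zero => exact P.map_zero.trans Q.map_zero.symm
    | add x y hx hy => exact (P.map_add x y).trans ((congrArg₂ _ hx hy).trans (Q.map_add x y).symm)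
    | of p α => exact h p α

theorem iota_of_zero (X : SmoothVF E M) (f : DForm E M 0) : iota X (of 0 f) = 0 :=
  DForms.iota_lof_zero X f

theorem iota_of_succ (X : SmoothVF E M) {p : ℕ} (σ : DForm E M (p + 1)) :
    iota X (of (p + 1) σ) = of p (σ.curryLeft X) :=
  DForms.iota_lof_succ X σ

theorem comp_iota_evSeq (X : SmoothVF E M) (w : TForms E M) (n : ℕ) (u : ℕ → SmoothVF E M) :
    (comp n (iota X w)).evSeq u = (comp (n + 1) w).evSeq (seqCons X u) :=
  DForms.iota_evSeq X w n u

theorem eq_of_iota {w w' : TForms E M} (h : ∀ X, iota X w = iota X w')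
    (h0 : comp 0 w = comp 0 w') : w = w' :=
  DForms.eq_of_iota h h0

theorem wedge_of {p q : ℕ} (α : DForm E M p) (β : DForm E M q) :
    wedge (of p α) (of q β) = of (p + q) (_root_.wedge p q α β) :=
  DForms.wedgeTotal_lof α β

theorem iota_wedge (X : SmoothVF E M) {p : ℕ} (α : DForm E M p) (w : TForms E M) :
    iota X (wedge (of p α) w) = wedge (iota X (of p α)) w +
      (-1 : ℝ) ^ p • wedge (of p α) (iota X w) :=
  DForms.iota_wedgeTotal X α w

theorem ins_of_zero {k : ℕ} (Ψ : VForm E M k) (f : DForm E M 0) : ins Ψ (of 0 f) = 0 :=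
  DForms.insertion_lof_zero Ψ f

theorem ins_of_succ {k p : ℕ} (Ψ : VForm E M k) (σ : DForm E M (p + 1)) :
    ins Ψ (of (p + 1) σ) = of (k + p) (contraction k p Ψ σ) :=
  DForms.insertion_lof_succ Ψ σ

theorem iota_mul_ins {k : ℕ} (Ψ : VForm E M (k + 1)) (X : SmoothVF E M) :
    iota X * ins Ψ = ins (Ψ.curryLeft X) + (-1 : ℝ) ^ k • (ins Ψ * iota X) :=
  congrArg lift (DForms.iota_insertion Ψ X)

theorem ins_ofDual {k : ℕ} (Ψ : VForm E M k) (θ : Module.Dual (SmoothFn E M) (SmoothVF E M)) :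
    ins Ψ (ofDual θ) = of k (θ.compAlternatingMap Ψ) :=
  DForms.insertion_ofDual Ψ θ

theorem exists_ofDual (α : DForm E M 1) : ∃ θ, of 1 α = ofDual θ :=
  DForms.exists_ofDual α

theorem ins_zero_form (Ψ : VForm E M 0) : ins Ψ = iota (Ψ ![]) := by
  refine Eq.trans ?_ (congrArg lift (DForms.insertion_constOfIsEmpty (Ψ ![])))
  change ins Ψ = ins _
  congr 1
  ext1 v
  rw [AlternatingMap.constOfIsEmpty_apply]
  congr 1
  exact Subsingleton.elim _ _

theorem act_of (R : EndTM E M) {p : ℕ} (σ : DForm E M p) :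
    act R (of p σ) = of p (σ.compLinearMap R) := by
  refine (DirectSum.toModule_lof ℝ p σ).trans ?_
  rfl

theorem act_of_zero (R : EndTM E M) (f : DForm E M 0) : act R (of 0 f) = of 0 f := by
  rw [act_of]
  congr 1
  ext1 v
  rw [AlternatingMap.compLinearMap_apply]
  congr 1
  exact Subsingleton.elim _ _

theorem act_mul (R S : EndTM E M) : act (R * S) = act S * act R := by
  refine end_ext fun p σ => ?_
  rw [Module.End.mul_apply, act_of, act_of, act_of]
  rfl

theorem act_one : act (1 : EndTM E M) = 1 := by
  refine end_ext fun p σ => ?_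
  rw [act_of]
  rfl

theorem iota_mul_act (R : EndTM E M) (X : SmoothVF E M) :
    iota X * act R = act R * iota (R X) := by
  refine end_ext fun p σ => ?_
  rw [Module.End.mul_apply, Module.End.mul_apply, act_of]
  cases p with
  | zero => rw [iota_of_zero, iota_of_zero, map_zero]
  | succ p =>
    rw [iota_of_succ, iota_of_succ, act_of]
    exact congrArg (of p) (AlternatingMap.curryLeft_compLinearMap R σ X)

theorem act_ofDual (R : EndTM E M) (θ : Module.Dual (SmoothFn E M) (SmoothVF E M)) :
    act R (ofDual θ) = ofDual (θ ∘ₗ R) :=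
  act_of R _

/-- `P` is homogeneous of degree `n`. -/
def IsHomogeneous (n : ℕ) (P : Module.End ℝ (TForms E M)) : Prop :=
  ∀ (p : ℕ) (α : DForm E M p) (q : ℕ), q ≠ p + n → comp q (P (of p α)) = 0

/-- `IsDer n P`: a description of the graded derivations of degree `n - 1` by means of their
iterated commutators with interior products. -/
def IsDer : ℕ → Module.End ℝ (TForms E M) → Prop
  | 0, P => ∃ Y, P = iota Y
  | n + 1, P => IsHomogeneous n P ∧
      (n = 0 → ∀ f g : DForm E M 0, P (wedge (of 0 f) (of 0 g)) =
        wedge (P (of 0 f)) (of 0 g) + wedge (of 0 f) (P (of 0 g))) ∧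
      ∀ X, IsDer n (iota X * P + (-1 : ℝ) ^ (n + 1) • (P * iota X))

namespace IsHomogeneous

variable {n m : ℕ} {P Q : Module.End ℝ (TForms E M)}

theorem apply_of (h : IsHomogeneous n P) {p : ℕ} (α : DForm E M p) :
    P (of p α) = of (p + n) (comp (p + n) (P (of p α))) := by
  refine ext_comp fun q => ?_
  by_cases hq : q = p + n
  · subst hq
    rw [comp_of]
  · rw [h p α q hq, comp_of_ne hq]

theorem add (hP : IsHomogeneous n P) (hQ : IsHomogeneous n Q) : IsHomogeneous n (P + Q) := by
  intro p α q hq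
  rw [LinearMap.add_apply, map_add, hP p α q hq, hQ p α q hq, add_zero]

theorem smul (hP : IsHomogeneous n P) (c : ℝ) : IsHomogeneous n (c • P) := by
  intro p α q hq
  rw [LinearMap.smul_apply, map_smul, hP p α q hq, smul_zero]

theorem mul (hP : IsHomogeneous n P) (hQ : IsHomogeneous m Q) : IsHomogeneous (n + m) (P * Q) := by
  intro p α q hq
  rw [Module.End.mul_apply, hQ.apply_of α]
  exact hP _ _ _ (by omega)

end IsHomogeneous

namespace IsDer

variable {n m : ℕ} {P Q : Module.End ℝ (TForms E M)}

theorem comm_iota (h : IsDer (n + 1) P) (X : SmoothVF E M) :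
    IsDer n (iota X * P + (-1 : ℝ) ^ (n + 1) • (P * iota X)) := h.2.2 X

theorem add (hP : IsDer n P) (hQ : IsDer n Q) : IsDer n (P + Q) := by
  induction n generalizing P Q with
  | zero =>
    obtain ⟨Y, rfl⟩ := hP
    obtain ⟨Z, rfl⟩ := hQ
    exact ⟨Y + Z, (map_add iota Y Z).symm⟩
  | succ n ih =>
    refine ⟨hP.1.add hQ.1, fun hn f g => ?_, fun X => ?_⟩
    · simp only [LinearMap.add_apply, map_add, hP.2.1 hn, hQ.2.1 hn]
      abel
    · convert ih (hP.2.2 X) (hQ.2.2 X) using 1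
      simp only [mul_add, add_mul, smul_add]
      abel

theorem smul (hP : IsDer n P) (c : ℝ) : IsDer n (c • P) := by
  induction n generalizing P with
  | zero =>
    obtain ⟨Y, rfl⟩ := hP
    exact ⟨c • Y, (map_smul iota c Y).symm⟩
  | succ n ih =>
    refine ⟨hP.1.smul c, fun hn f g => ?_, fun X => ?_⟩
    · simp only [LinearMap.smul_apply, map_smul, hP.2.1 hn, smul_add]
    · convert ih (hP.2.2 X) using 1
      rw [mul_smul_comm, smul_mul_assoc, smul_add, smul_comm c]

theorem neg (hP : IsDer n P) : IsDer n (-P) := by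
  simpa using hP.smul (-1)

theorem sub (hP : IsDer n P) (hQ : IsDer n Q) : IsDer n (P - Q) := by
  simpa [sub_eq_add_neg] using hP.add hQ.neg

/-- The graded Jacobi identity `[ι_X, [P, Q]] = [[ι_X, P], Q] + (-1)^m [P, [ι_X, Q]]` (`key`) lowers
one degree in each term, so induction on `m + n` applies. Once a factor has dropped to some `ι_Y`,
its bracket with the other factor is covered by the definition of `IsDer`. For `m = n = 0` the
Leibniz rule on functions is checked directly. -/
theorem commutator (hP : IsDer (m + 1) P) (hQ : IsDer (n + 1) Q) :
    IsDer (m + n + 1) (P * Q - (-1 : ℝ) ^ (m * n) • (Q * P)) := by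
  induction hN : m + n generalizing m n P Q with
  | zero =>
    obtain ⟨rfl, rfl⟩ : m = 0 ∧ n = 0 := by omega
    refine ⟨?_, fun _ f g => ?_, fun X => ?_⟩
    · rw [sub_eq_add_neg, ← neg_smul]
      exact (hP.1.mul hQ.1).add ((hQ.1.mul hP.1).smul _)
    · have e1 : ∀ f, P (of 0 f) = of 0 (comp 0 (P (of 0 f))) := hP.1.apply_of
      have e2 : ∀ f, Q (of 0 f) = of 0 (comp 0 (Q (of 0 f))) := hQ.1.apply_of
      have l1 := hP.2.1 rfl
      have l2 := hQ.2.1 rfl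
      simp only [mul_zero, pow_zero, one_smul, LinearMap.sub_apply, Module.End.mul_apply, l1, l2,
        map_add]
      have a1 := l1 (comp 0 (Q (of 0 f))) g
      have a2 := l1 f (comp 0 (Q (of 0 g)))
      have a3 := l2 (comp 0 (P (of 0 f))) g
      have a4 := l2 f (comp 0 (P (of 0 g)))
      rw [← e1] at a3 a4
      rw [← e2] at a1 a2
      rw [a1, a2, a3, a4]
      simp only [map_sub, LinearMap.sub_apply]
      abel
    · obtain ⟨Y, hY⟩ := hP.comm_iota X
      obtain ⟨Z, hZ⟩ := hQ.comm_iota X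
      have h1 := hQ.comm_iota Y
      have h2 := (hP.comm_iota Z).neg
      convert h1.add h2 using 1
      rw [← hY, ← hZ]
      simp only [mul_zero, zero_add, pow_zero, pow_one, one_smul, neg_smul]
      noncomm_ring
  | succ N ih =>
    have key : ∀ X, iota X * (P * Q - (-1 : ℝ) ^ (m * n) • (Q * P)) +
        (-1 : ℝ) ^ (m + n + 1) • ((P * Q - (-1 : ℝ) ^ (m * n) • (Q * P)) * iota X) =
        ((iota X * P + (-1 : ℝ) ^ (m + 1) • (P * iota X)) * Q - (-1 : ℝ) ^ (m * n + n) •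
          (Q * (iota X * P + (-1 : ℝ) ^ (m + 1) • (P * iota X)))) +
        (-1 : ℝ) ^ m • (P * (iota X * Q + (-1 : ℝ) ^ (n + 1) • (Q * iota X)) -
          (-1 : ℝ) ^ (m * n + m) •
          ((iota X * Q + (-1 : ℝ) ^ (n + 1) • (Q * iota X)) * P)) := by
      intro X
      simp only [pow_add, pow_one]
      rcases neg_one_pow_eq_or ℝ m with h | h <;> rcases neg_one_pow_eq_or ℝ n with h' | h' <;>
        rcases neg_one_pow_eq_or ℝ (m * n) with h'' | h'' <;> rw [h, h', h''] <;>
        simp only [mul_one, mul_neg, neg_smul, one_smul, neg_neg] <;> noncomm_ring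
    refine ⟨?_, fun h => absurd h (by omega), fun X => ?_⟩
    · rw [sub_eq_add_neg, ← neg_smul, ← hN]
      have h2 := hQ.1.mul hP.1
      rw [add_comm] at h2
      exact (hP.1.mul hQ.1).add (h2.smul _)
    · rw [← hN, key X]
      refine add (n := m + n) ?_ (smul ?_ _)
      · cases m with
        | zero =>
          obtain ⟨Y, hY⟩ := hP.comm_iota X
          rw [hY]
          convert hQ.comm_iota Y using 1
          · rw [zero_add]
          · rw [zero_mul, zero_add, pow_succ, mul_neg_one, neg_smul, sub_eq_add_neg]
        | succ m =>
          have h1 := ih (hP.comm_iota X) hQ (by omega)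
          have h2 : (-1 : ℝ) ^ ((m + 1) * n + n) = (-1) ^ (m * n) := by
            rw [add_mul, one_mul, add_assoc, ← two_mul, pow_add]
            simp
          rw [hN, h2]
          exact h1
      · cases n with
        | zero =>
          obtain ⟨Z, hZ⟩ := hQ.comm_iota X
          rw [hZ, add_zero]
          convert ((hP.comm_iota Z).smul (-(-1 : ℝ) ^ m)) using 1
          rw [mul_zero, zero_add, smul_add, smul_smul, pow_succ, mul_neg_one, neg_mul_neg,
            ← mul_pow, neg_smul]
          simp only [neg_mul_neg, mul_one, one_pow, one_smul]
          abel
        | succ n =>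
          have h1 := ih hP (hQ.comm_iota X) (by omega)
          have h2 : (-1 : ℝ) ^ (m * (n + 1) + m) = (-1) ^ (m * n) := by
            rw [mul_add, mul_one, add_assoc, ← two_mul, pow_add]
            simp
          rw [hN, h2]
          exact h1

/-- After contraction with `X`, the rule follows from that of the commutator `D` with `ι_X`, one
degree lower, and from the rule for `P` on pairs of smaller total degree. Function parts can be
nonzero only for `p = q = n = 0`, which is why `IsDer` demands a Leibniz rule only there. -/
theorem wedge_of_of (hP : IsDer (n + 1) P)
    (ih : ∀ X (D : Module.End ℝ (TForms E M)), D = iota X * P + (-1 : ℝ) ^ (n + 1) • (P * iota X) →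
      ∀ p (α : DForm E M p) w, D (wedge (of p α) w) = wedge (D (of p α)) w +
        (-1 : ℝ) ^ ((n + 1) * p) • wedge (of p α) (D w))
    {p q : ℕ} (α : DForm E M p) (β : DForm E M q) :
    P (wedge (of p α) (of q β)) = wedge (P (of p α)) (of q β) +
      (-1 : ℝ) ^ (n * p) • wedge (of p α) (P (of q β)) := by
  induction hN : p + q using Nat.strong_induction_on generalizing p q with
  | _ N ihN =>
  refine eq_of_iota (fun X => ?_) ?_
  · obtain ⟨D, hD⟩ : ∃ D, D = iota X * P + (-1 : ℝ) ^ (n + 1) • (P * iota X) := ⟨_, rfl⟩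
    have h1 : ∀ w, iota X (P w) = D w + (-1 : ℝ) ^ n • P (iota X w) := by
      intro w
      rw [hD, LinearMap.add_apply, LinearMap.smul_apply, pow_succ, mul_neg_one, neg_smul]
      simp
    have h2 : P (wedge (iota X (of p α)) (of q β)) = wedge (P (iota X (of p α))) (of q β) +
      (-1 : ℝ) ^ (n * p + n) • wedge (iota X (of p α)) (P (of q β)) := by
      cases p with
      | zero => simp [iota_of_zero]
      | succ p =>
        rw [iota_of_succ, ihN (p + q) (by omega) _ _ rfl, mul_add, mul_one, add_assoc, ← two_mul,
          pow_add _ _ (2 * n)]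
        simp
    have h3 : P (wedge (of p α) (iota X (of q β))) = wedge (P (of p α)) (iota X (of q β)) +
      (-1 : ℝ) ^ (n * p) • wedge (of p α) (P (iota X (of q β))) := by
      cases q with
      | zero => simp [iota_of_zero]
      | succ q => rw [iota_of_succ, ihN (p + q) (by omega) _ _ rfl]
    have h4 : iota X (wedge (P (of p α)) (of q β)) = wedge (iota X (P (of p α))) (of q β) +
        (-1 : ℝ) ^ (p + n) • wedge (P (of p α)) (iota X (of q β)) := by
      rw [hP.1.apply_of α, iota_wedge]
    rw [h1, ih X D hD, iota_wedge, map_add, map_smul, h2, h3, map_add, map_smul, h4, iota_wedge, h1, h1]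
    simp only [pow_add, add_mul, one_mul, map_add, map_smul, LinearMap.add_apply,
      LinearMap.smul_apply]
    rcases neg_one_pow_eq_or ℝ n with h | h <;> rcases neg_one_pow_eq_or ℝ p with h' | h' <;>
        rcases neg_one_pow_eq_or ℝ (n * p) with h'' | h'' <;> rw [h, h', h''] <;> module
  · by_cases h0 : p + q + n = 0
    · obtain ⟨rfl, rfl, rfl⟩ : p = 0 ∧ q = 0 ∧ n = 0 := by omega
      rw [hP.2.1 rfl]
      simp
    · rw [wedge_of, hP.1 _ _ _ (Ne.symm h0), map_add, map_smul, hP.1.apply_of α,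
        hP.1.apply_of β, wedge_of, wedge_of, comp_of_ne (by omega), comp_of_ne (by omega)]
      simp

/-- The index `n` stands for degree `n - 1`, which has the parity of `n + 1`; hence the exponent. -/
theorem map_wedge (hP : IsDer n P) {p : ℕ} (α : DForm E M p) (w : TForms E M) :
    P (wedge (of p α) w) = wedge (P (of p α)) w +
      (-1 : ℝ) ^ ((n + 1) * p) • wedge (of p α) (P w) := by
  induction n generalizing P p α w with
  | zero =>
    obtain ⟨Y, rfl⟩ := hP
    rw [zero_add, one_mul]
    exact iota_wedge Y α w
  | succ n ih =>
    have h := fun q => hP.wedge_of_of (fun X D hD p α w => ih (hD ▸ hP.comm_iota X) α w)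
      (p := p) (q := q)
    have : (-1 : ℝ) ^ ((n + 1 + 1) * p) = (-1 : ℝ) ^ (n * p) := by
      rw [add_assoc, add_mul, pow_add]
      simp
    rw [this]
    have h2 : P * wedge (of p α) = wedge (P (of p α)) +
        (-1 : ℝ) ^ (n * p) • (wedge (of p α) * P : Module.End ℝ (TForms E M)) :=
      end_ext fun q β => h q α β
    exact LinearMap.congr_fun h2 w

/-- `act` reverses products, so `act R * act S = 1`. Since `ι_X` passes through `act R` as `ι_{R
X}`, commuting with `ι_X` conjugates the commutator of `P` with `ι_{R X}`. -/
theorem conj (hP : IsDer n P) {R S : EndTM E M} (hSR : S * R = 1) :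
    IsDer n (act R * P * act S) := by
  have h2 : act R * act S = 1 := by rw [← act_mul, hSR, act_one]
  have hS : ∀ X, act S * iota X = iota (R X) * act S := by
    intro X
    rw [iota_mul_act, ← Module.End.mul_apply, hSR, Module.End.one_apply]
  induction n generalizing P with
  | zero =>
    obtain ⟨Y, rfl⟩ := hP
    refine ⟨S Y, ?_⟩
    rw [mul_assoc, iota_mul_act, ← mul_assoc, h2, one_mul]
  | succ n ih =>
    refine ⟨fun p α q hq => ?_, fun hn f g => ?_, fun X => ?_⟩
    · rw [Module.End.mul_apply, Module.End.mul_apply, act_of, hP.1.apply_of, act_of,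
        comp_of_ne hq]
    · subst hn
      have h0 : ∀ f : DForm E M 0, act R (P (of 0 f)) = P (of 0 f) := by
        intro f
        rw [hP.1.apply_of]
        exact act_of_zero R _
      have h3 : wedge (of 0 f) (of 0 g) = of 0 (_root_.wedge 0 0 f g) := wedge_of f g
      simp only [Module.End.mul_apply, h3, act_of_zero, h0]
      rw [← h3, hP.2.1 rfl]
    · convert ih (hP.2.2 (R X)) using 1
      rw [mul_add, add_mul, ← mul_assoc, ← mul_assoc, iota_mul_act, mul_smul_comm,
        smul_mul_assoc, mul_assoc _ _ (iota X), hS]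
      simp only [mul_assoc]

end IsDer

theorem iota_comm_ins {k : ℕ} (Ψ : VForm E M (k + 1)) (X : SmoothVF E M) :
    iota X * ins Ψ + (-1 : ℝ) ^ (k + 1) • (ins Ψ * iota X) = ins (Ψ.curryLeft X) := by
  rw [iota_mul_ins, pow_succ, mul_neg_one, neg_smul, add_neg_cancel_right]

theorem isDer_ins {k : ℕ} (Ψ : VForm E M k) : IsDer k (ins Ψ) := by
  induction k with
  | zero => exact ⟨_, ins_zero_form Ψ⟩
  | succ k ih =>
    refine ⟨fun p σ q hq => ?_, fun _ f g => ?_, fun X => ?_⟩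
    · cases p with
      | zero => rw [ins_of_zero, map_zero]
      | succ p => rw [ins_of_succ, comp_of_ne (by omega)]
    · rw [wedge_of]
      simp only [ins_of_zero, map_zero, LinearMap.zero_apply, add_zero]
      exact ins_of_zero Ψ _
    · rw [iota_comm_ins]
      exact ih _

/-- A smooth function as an element of `Λ^* M`. -/
def fn (f : SmoothFn E M) : TForms E M :=
  of 0 (AlternatingMap.constOfIsEmpty (SmoothFn E M) (SmoothVF E M) (Fin 0) f)

theorem exists_fn (α : DForm E M 0) : ∃ f, of 0 α = fn f := by
  refine ⟨α ![], congrArg (of 0) ?_⟩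
  ext1 v
  rw [AlternatingMap.constOfIsEmpty_apply]
  congr 1
  exact Subsingleton.elim _ _

theorem wedge_fn (f g : SmoothFn E M) : wedge (fn f) (fn g) = fn (f * g) := by
  rw [fn, fn, wedge_of, fn]
  refine congrArg (of 0) (AlternatingMap.ext_evSeq fun u => ?_)
  exact shuffleProduct_zero_zero _ _ _ u

/-- The differential of a function. -/
def diff (f : SmoothFn E M) : Module.Dual (SmoothFn E M) (SmoothVF E M) where
  toFun X := SmoothVF.deriv X f
  map_add' X Y := by rw [map_add]; rfl
  map_smul' c X := by rw [map_smul]; rfl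

theorem diff_apply (f : SmoothFn E M) (X : SmoothVF E M) : diff f X = SmoothVF.deriv X f := rfl

theorem comp_iota (X : SmoothVF E M) (w : TForms E M) (n : ℕ) :
    comp n (iota X w) = (comp (n + 1) w).curryLeft X :=
  AlternatingMap.ext_evSeq fun u => by
    rw [comp_iota_evSeq, AlternatingMap.evSeq_seqCons]

theorem iota_fn (X : SmoothVF E M) (f : SmoothFn E M) : iota X (fn f) = 0 := iota_of_zero X _

theorem ins_fn {k : ℕ} (Ψ : VForm E M k) (f : SmoothFn E M) : ins Ψ (fn f) = 0 := ins_of_zero Ψ _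

theorem act_fn (R : EndTM E M) (f : SmoothFn E M) : act R (fn f) = fn f := act_of_zero R _

theorem lift_units_smul (u : ℤˣ) (P : Module.End ℝ (DForms E M)) :
    lift (u • P) = ((u : ℤ) : ℝ) • lift P := by
  have h : lift (u • P) = u • lift P := rfl
  rw [h]
  rcases Int.units_eq_one_or u with rfl | rfl
  · simp
  · rw [Units.smul_def]
    simp

theorem lift_insertion {k : ℕ} (Ψ : VForm E M k) : lift (insertion Ψ) = ins Ψ := rfl

theorem ins_toVForm_ofDual (Φ : EndTM E M) (θ : Module.Dual (SmoothFn E M) (SmoothVF E M)) :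
    ins Φ.toVForm (ofDual θ) = ofDual (θ ∘ₗ Φ) :=
  ins_ofDual _ θ

theorem iota_mul_ins_toVForm (Φ : EndTM E M) (X : SmoothVF E M) :
    iota X * ins Φ.toVForm = iota (Φ X) + ins Φ.toVForm * iota X := by
  rw [iota_mul_ins, pow_zero, one_smul, ins_zero_form]
  rfl

theorem lift_sum {ι : Type*} (s : Finset ι) (P : ι → Module.End ℝ (DForms E M)) :
    lift (∑ i ∈ s, P i) = ∑ i ∈ s, lift (P i) :=
  map_sum (⟨⟨lift, lift_zero⟩, lift_add⟩ : Module.End ℝ (DForms E M) →+ Module.End ℝ (TForms E M))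
    P s

theorem isGradedDerivation_of_isDer {D : Module.End ℝ (DForms E M)} (h : IsDer 2 (lift D)) :
    IsGradedDerivation 1 D := by
  refine ⟨fun p α q hq => ?_, fun p α w => ?_⟩
  · have h1 : q ≠ p + 1 := by omega
    exact h.1 p α q h1
  have h1 : ∀ w : TForms E M, (1 * (p : ℤ)).negOnePow • w = (-1 : ℝ) ^ p • w := by
    intro w
    rw [one_mul, Int.negOnePow_def, zpow_natCast]
    rcases neg_one_pow_eq_or ℤˣ p with h | h
    · have h2 : (-1 : ℝ) ^ p = 1 := by simpa using congrArg (fun u : ℤˣ => ((u : ℤ) : ℝ)) h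
      rw [h, h2, one_smul, one_smul]
    · have h2 : (-1 : ℝ) ^ p = -1 := by simpa using congrArg (fun u : ℤˣ => ((u : ℤ) : ℝ)) h
      rw [h, h2, Units.neg_smul, one_smul, neg_one_smul]
  have h2 := h.map_wedge α w
  -- Index `2` is degree `1`, so the sign must reduce to `(-1)^p`.
  have h3 : (-1 : ℝ) ^ ((2 + 1) * p) = (-1) ^ p := by
    rw [pow_mul]
    norm_num
  rw [h3, ← h1] at h2
  exact h2

theorem lift_gradedComm (k l : ℤ) (P Q : Module.End ℝ (DForms E M)) :
    lift (gradedComm k l P Q) =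
      lift P * lift Q - (((k * l).negOnePow : ℤ) : ℝ) • (lift Q * lift P) := by
  rw [gradedComm, lift_sub, lift_units_smul, lift_mul, lift_mul]

theorem lift_gradedComm_one (P Q : Module.End ℝ (DForms E M)) :
    lift (gradedComm 1 1 P Q) = lift P * lift Q + lift Q * lift P := by
  rw [lift_gradedComm]
  simp

theorem act_one_add_ofDual (Φ : EndTM E M) (θ : Module.Dual (SmoothFn E M) (SmoothVF E M)) :
    act (1 + Φ) (ofDual θ) = ofDual θ + ins Φ.toVForm (ofDual θ) := by
  rw [act_ofDual, ins_toVForm_ofDual, ← map_add]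
  congr 1
  ext1 X
  exact map_add θ X (Φ X)

/-- Expanding `α (X + ΦX, Y + ΦY)` leaves the quadratic term `α (ΦX, ΦY)`. It occurs twice in `ℐ_Φ
ℐ_Φ α`, whose remaining terms form `ℐ_{Φ²} α`. -/
theorem act_one_add_of_two (Φ : EndTM E M) (α : DForm E M 2) :
    act (1 + Φ) (of 2 α) = of 2 α + ins Φ.toVForm (of 2 α) + (1 / 2 : ℝ) •
      (ins Φ.toVForm (ins Φ.toVForm (of 2 α)) - ins (Φ * Φ).toVForm (of 2 α)) := by
  have hi : ∀ (Φ : EndTM E M) (X : SmoothVF E M) (w : TForms E M),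
      iota X (ins Φ.toVForm w) = iota (Φ X) w + ins Φ.toVForm (iota X w) :=
    fun Φ X w => LinearMap.congr_fun (iota_mul_ins_toVForm Φ X) w
  have h1 : ∀ X : SmoothVF E M, ∃ θ, iota X (of 2 α) = ofDual θ := by
    intro X
    rw [iota_of_succ]
    exact exists_ofDual _
  refine eq_of_iota (fun X => ?_) ?_
  · have h2 : iota X (act (1 + Φ) (of 2 α)) = act (1 + Φ) (iota ((1 + Φ) X) (of 2 α)) :=
      LinearMap.congr_fun (iota_mul_act (1 + Φ) X) _
    obtain ⟨θ, hθ⟩ := h1 X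
    obtain ⟨θ', hθ'⟩ := h1 (Φ X)
    have h3 : (1 + Φ) X = X + Φ X := rfl
    have h4 : (Φ * Φ) X = Φ (Φ X) := rfl
    rw [h2, h3]
    simp only [map_add, map_smul, map_sub, LinearMap.add_apply, hi, hθ, hθ', h4, act_one_add_ofDual]
    have h5 : ins (Φ * Φ).toVForm (ofDual θ) = ins Φ.toVForm (ins Φ.toVForm (ofDual θ)) := by
      rw [ins_toVForm_ofDual, ins_toVForm_ofDual, ins_toVForm_ofDual]
      rfl
    rw [h5]
    module
  · have h2 : ∀ (Φ : EndTM E M) (β : DForm E M 2), comp 0 (ins Φ.toVForm (of 2 β)) = 0 :=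
      fun Φ β => (isDer_ins Φ.toVForm).1 2 β 0 (by omega)
    have h3 := (isDer_ins Φ.toVForm).1.apply_of α
    have h4 : comp 0 (of 2 α) = 0 := comp_of_ne (by omega) α
    rw [act_of, comp_of_ne (by omega), map_add, map_add, map_smul, map_sub, h2, h2, h4, h3]
    have h5 := h2 Φ (comp (2 + 0) (ins Φ.toVForm (of 2 α)))
    change _ = 0 + 0 + (1 / 2 : ℝ) • (comp 0 (ins Φ.toVForm (of 2 _)) - 0)
    rw [h5]
    simp

end TForms

end Derivations

/-! ### Vector fields as derivations of functions. -/

noncomputable section VectorFields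

variable {E : Type*} [NormedAddCommGroup E] [NormedSpace ℝ E] [FiniteDimensional ℝ E]
  {M : Type*} [TopologicalSpace M] [ChartedSpace E M] [IsManifold 𝓘(ℝ, E) ∞ M]

namespace SmoothVF

theorem bracket_jacobi (X Y Z : SmoothVF E M) :
    bracket X (bracket Y Z) = bracket (bracket X Y) Z + bracket Y (bracket X Z) := by
  have := FiniteDimensional.complete ℝ E
  have : IsManifold 𝓘(ℝ, E) 3 M :=
    IsManifold.of_le (n := ∞) (WithTop.coe_le_coe.2 le_top)
  have : IsManifold 𝓘(ℝ, E) (minSmoothness ℝ 3) M := by simpa using this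
  have h2 : (2 : WithTop ℕ∞) ≤ ∞ := WithTop.coe_le_coe.2 le_top
  have h : ∀ X : SmoothVF E M, ContMDiff 𝓘(ℝ, E) (𝓘(ℝ, E).prod 𝓘(ℝ, E)) (minSmoothness ℝ 2)
      (fun y => (X y : TangentBundle 𝓘(ℝ, E) M)) := fun X =>
    X.contMDiff.of_le (by simpa using h2)
  ext x
  exact VectorField.leibniz_identity_mlieBracket_apply (h X x) (h Y x) (h Z x)

/-- The Jacobi identity for `X`, `Y`, `f • Z`, expanded by the Leibniz rule, shows that the defect
of the formula annihilates every `Z`. At a point where some `Z` is nonzero the defect vanishes; at a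
point where all vector fields vanish, so do all the derivatives involved. -/
theorem deriv_bracket (X Y : SmoothVF E M) (f : SmoothFn E M) :
    deriv (bracket X Y) f = deriv X (deriv Y f) - deriv Y (deriv X f) := by
  have key : ∀ Z : SmoothVF E M,
      (deriv (bracket X Y) f - (deriv X (deriv Y f) - deriv Y (deriv X f))) • Z = 0 := by
    intro Z
    have h1 := bracket_jacobi X Y (f • Z)
    simp only [bracket_smul, map_add] at h1
    rw [bracket_jacobi X Y Z, smul_add] at h1
    have h2 : deriv (bracket X Y) f • Z - (deriv X (deriv Y f) • Z - deriv Y (deriv X f) • Z) = 0 := by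
      rw [sub_eq_zero]
      rw [← sub_eq_zero] at h1 ⊢
      rw [← neg_eq_zero, ← h1]
      abel
    rw [sub_smul, sub_smul]
    exact h2
  rw [← sub_eq_zero]
  ext x
  by_cases hx : ∃ Z : SmoothVF E M, Z x ≠ 0
  · obtain ⟨Z, hZ⟩ := hx
    have h1 := congrArg (fun W : SmoothVF E M => W x) (key Z)
    exact (smul_eq_zero.1 h1).resolve_right hZ
  · push Not at hx
    have h1 : ∀ (Z : SmoothVF E M) (g : SmoothFn E M), deriv Z g x = 0 := by
      intro Z g
      change mvfderiv 𝓘(ℝ, E) g x (Z x) = 0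
      rw [hx, map_zero]
    change deriv (bracket X Y) f x - (deriv X (deriv Y f) x - deriv Y (deriv X f) x) = 0
    simp [h1]

/-- If `Y` is nonzero at `x`, a linear functional of the chart at `x`, cut off by a bump function,
has nonzero derivative along `Y` there. The cut-off is globally smooth because `M` is Hausdorff. -/
theorem eq_zero_of_deriv [T2Space M] (Y : SmoothVF E M) (h : ∀ f, deriv Y f = 0) : Y = 0 := by
  ext x
  change Y x = 0
  have h1 : IsManifold 𝓘(ℝ, E) 1 M := IsManifold.of_le (n := ∞) (by simp)
  by_contra hY
  obtain ⟨e, he⟩ := isInvertible_mfderiv_extChartAt (I := 𝓘(ℝ, E)) (mem_extChartAt_source (I := 𝓘(ℝ, E)) x)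
  have hv : e (Y x) ≠ 0 := by
    intro h0
    exact hY (e.map_eq_zero_iff.1 h0)
  have hdual : ∀ v : E, v ≠ 0 → ∃ ℓ : E →L[ℝ] ℝ, ℓ v ≠ 0 := fun v hv =>
    SeparatingDual.exists_ne_zero hv
  obtain ⟨ℓ, hℓ⟩ := hdual (e (Y x)) hv
  obtain ⟨χ⟩ : Nonempty (SmoothBumpFunction 𝓘(ℝ, E) x) := inferInstance
  have hg : ContMDiffOn 𝓘(ℝ, E) 𝓘(ℝ, ℝ) ∞ (fun y => ℓ (extChartAt 𝓘(ℝ, E) x y)) (chartAt E x).source :=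
    ℓ.contMDiff.comp_contMDiffOn contMDiffOn_extChartAt
  let f : SmoothFn E M := ⟨fun y => χ y • ℓ (extChartAt 𝓘(ℝ, E) x y), χ.contMDiff_smul hg⟩
  have hf : (f : M → ℝ) =ᶠ[nhds x] fun y => ℓ (extChartAt 𝓘(ℝ, E) x y) := by
    filter_upwards [χ.eventuallyEq_one] with y hy
    change χ y • ℓ (extChartAt 𝓘(ℝ, E) x y) = _
    rw [hy]
    exact one_smul ℝ _
  have h2 : mvfderiv 𝓘(ℝ, E) f x (Y x) = 0 := congrArg (fun f : SmoothFn E M => f x) (h f)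
  have h3 : mvfderiv 𝓘(ℝ, E) f x (Y x) = ℓ (e (Y x)) := by
    have h4 : mfderiv 𝓘(ℝ, E) 𝓘(ℝ, ℝ) f x = mfderiv 𝓘(ℝ, E) 𝓘(ℝ, ℝ) (ℓ ∘ extChartAt 𝓘(ℝ, E) x) x :=
      hf.mfderiv_eq
    have h5 : mfderiv 𝓘(ℝ, E) 𝓘(ℝ, ℝ) (ℓ ∘ extChartAt 𝓘(ℝ, E) x) x (Y x) =
        mfderiv 𝓘(ℝ, E) 𝓘(ℝ, ℝ) ℓ (extChartAt 𝓘(ℝ, E) x x)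
          (mfderiv 𝓘(ℝ, E) 𝓘(ℝ, E) (extChartAt 𝓘(ℝ, E) x) x (Y x)) :=
      mfderiv_comp_apply x (ℓ.contMDiff (n := ∞).contMDiffAt.mdifferentiableAt (by simp))
        (mdifferentiableAt_extChartAt (mem_chart_source E x)) (Y x)
    rw [ContinuousLinearMap.mfderiv_eq, ← he] at h5
    exact (congrArg (fun T => T (Y x)) h4).trans h5
  exact hℓ (h3 ▸ h2)

end SmoothVF

end VectorFields

/-! ### Cartan's formula for the Koszul expression. -/

noncomputable section Koszul

variable {R L : Type*} [CommRing R] [Algebra ℝ R] [AddCommGroup L] [Module R L] [Module ℝ L]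
  [IsScalarTower ℝ R L] {p : ℕ} {a : L →ₗ[R] Derivation ℝ R R} {b : L →ₗ[ℝ] L →ₗ[ℝ] L}

theorem koszulAux_cons_zero (η : L [⋀^Fin 0]→ₗ[R] R) (X : L) (w : Fin 0 → L) :
    koszulAux a b η (Fin.cons X w) = a X (η w) := by
  rw [koszulAux_apply]
  simp only [Fin.sum_univ_succ, Finset.univ_eq_empty, Finset.sum_empty, smul_zero, add_zero,
    Fin.val_zero, pow_zero, one_smul, Fin.cons_zero]
  congr 2

/-- Cartan's formula. -/
theorem koszulAux_cons_add (hb : ∀ X Y, b X Y = -b Y X) (η : L [⋀^Fin (p + 1)]→ₗ[R] R) (X : L)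
    (w : Fin (p + 1) → L) :
    koszulAux a b η (Fin.cons X w) + koszulAux a b (η.curryLeft X) w =
      a X (η w) + ∑ i, η (Function.update w i (b (w i) X)) := by
  rw [koszulAux_apply, koszulAux_apply, Fin.sum_univ_succ]
  have hrem : ∀ i : Fin (p + 1),
      (Fin.succ i).removeNth (Fin.cons X w : Fin (p + 2) → L) = Fin.cons X (i.removeNth w) := by
    intro i
    ext k
    refine Fin.cases ?_ (fun k => ?_) k <;> simp [Fin.removeNth]
  have h0 : (0 : Fin (p + 2)).removeNth (Fin.cons X w : Fin (p + 2) → L) = w := by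
    ext k
    simp [Fin.removeNth]
  have hneg : ∀ (Y : L) (u : Fin p → L), η (Fin.cons (-Y) u) = -η (Fin.cons Y u) := by
    intro Y u
    simpa using η.toMultilinearMap.cons_smul u (-1) Y
  have hins : ∀ i : Fin (p + 1), η (Function.update w i (b (w i) X)) =
      -((-1) ^ (i : ℕ) • η (Fin.cons (b X (w i)) (i.removeNth w))) := by
    intro i
    rw [← Fin.insertNth_removeNth, η.map_insertNth, hb, ← smul_neg, ← hneg]
    rfl
  -- The term of index `0` holds one half of the brackets with `X`. The other half is the `k = 0`
  -- summand of the terms of index `i.succ`, whose remainder cancels against the expression for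
  -- `η.curryLeft X`.
  have hj : ∀ i : Fin (p + 1),
      (-1) ^ ((i.succ : Fin (p + 2)) : ℕ) • (a ((Fin.cons X w : Fin (p + 2) → L) i.succ)
        (η ((Fin.succ i).removeNth (Fin.cons X w : Fin (p + 2) → L))) +
        (1 / 2 : ℝ) • ∑ k : Fin (p + 1), η (Function.update
          ((Fin.succ i).removeNth (Fin.cons X w : Fin (p + 2) → L)) k
          (b ((Fin.cons X w : Fin (p + 2) → L) (i.succ.succAbove k))
            ((Fin.cons X w : Fin (p + 2) → L) i.succ)))) =
      (1 / 2 : ℝ) • η (Function.update w i (b (w i) X)) -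
        (-1) ^ (i : ℕ) • (a (w i) (η.curryLeft X (i.removeNth w)) +
        (1 / 2 : ℝ) • ∑ k : Fin p, η.curryLeft X (Function.update (i.removeNth w) k
          (b (w (i.succAbove k)) (w i)))) := by
    intro i
    rw [hins, hrem, Fin.sum_univ_succ]
    simp only [Fin.cons_succ, Fin.succ_succAbove_zero, Fin.cons_zero, Fin.succ_succAbove_succ,
      Fin.val_succ, AlternatingMap.curryLeft_apply_apply, Matrix.vecCons, ← Fin.cons_update,
      Fin.update_cons_zero]
    rcases neg_one_pow_eq_or ℤ i with h | h <;> rw [pow_succ, h] <;> module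
  rw [Finset.sum_congr rfl fun i _ => hj i, Finset.sum_sub_distrib, ← Finset.smul_sum, h0]
  simp only [Fin.val_zero, pow_zero, one_smul, Fin.cons_zero, Fin.succAbove_zero, Fin.cons_succ]
  module

end Koszul

/-! ### The exterior derivative and Lie derivatives as graded derivations. -/

noncomputable section ExteriorDerivative

variable {E : Type*} [NormedAddCommGroup E] [NormedSpace ℝ E] [FiniteDimensional ℝ E]
  {M : Type*} [TopologicalSpace M] [ChartedSpace E M] [IsManifold 𝓘(ℝ, E) ∞ M]

theorem extDer_apply {p : ℕ} (η : DForm E M p) (v : Fin (p + 1) → SmoothVF E M) :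
    extDer p η v = koszulAux SmoothVF.deriv SmoothVF.bracket η v :=
  (koszulAux_apply SmoothVF.deriv SmoothVF.bracket η v).symm

namespace TForms

/-- The exterior derivative. -/
def d : Module.End ℝ (TForms E M) := lift extDerTotal

theorem d_of {p : ℕ} (η : DForm E M p) : d (of p η) = of (p + 1) (extDer p η) :=
  (DirectSum.toModule_lof ℝ p η).trans rfl

theorem isHomogeneous_d : IsHomogeneous 1 (d : Module.End ℝ (TForms E M)) := by
  intro p α q hq
  rw [d_of, comp_of_ne hq]

/-- The Lie derivative along a vector field. -/
def lie (X : SmoothVF E M) : Module.End ℝ (TForms E M) := iota X * d + d * iota X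

theorem isHomogeneous_lie (X : SmoothVF E M) : IsHomogeneous 0 (lie X) := by
  intro p α q hq
  rw [lie, LinearMap.add_apply, Module.End.mul_apply, Module.End.mul_apply, d_of, iota_of_succ]
  cases p with
  | zero => rw [iota_of_zero, map_zero, add_zero, comp_of_ne (by omega)]
  | succ p => rw [iota_of_succ, d_of, map_add, comp_of_ne (by omega), comp_of_ne (by omega), add_zero]

theorem comp_lie_of (X : SmoothVF E M) {p : ℕ} (η : DForm E M p) (v : Fin p → SmoothVF E M) :
    comp p (lie X (of p η)) v = SmoothVF.deriv X (η v) +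
      ∑ i, η (Function.update v i (SmoothVF.bracket (v i) X)) := by
  rw [lie, LinearMap.add_apply, Module.End.mul_apply, Module.End.mul_apply, d_of, iota_of_succ]
  cases p with
  | zero =>
    rw [iota_of_zero, map_zero, add_zero, comp_of, Finset.univ_eq_empty, Finset.sum_empty, add_zero,
      AlternatingMap.curryLeft_apply_apply, extDer_apply]
    exact koszulAux_cons_zero η X v
  | succ p =>
    rw [iota_of_succ, d_of, map_add, comp_of, comp_of, AlternatingMap.add_apply,
      AlternatingMap.curryLeft_apply_apply, extDer_apply, extDer_apply]
    exact koszulAux_cons_add SmoothVF.bracket_swap η X v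

/-- The two compositions differ only in the summand of the Lie derivative in which the bracket falls
on the inserted argument `Y`. -/
theorem iota_comm_lie (X Y : SmoothVF E M) :
    iota Y * lie X + (-1 : ℝ) • (lie X * iota Y) = iota (SmoothVF.bracket Y X) := by
  refine end_ext fun p η => ?_
  rw [LinearMap.add_apply, LinearMap.smul_apply, Module.End.mul_apply, Module.End.mul_apply,
    (isHomogeneous_lie X).apply_of η]
  cases p with
  | zero =>
    rw [iota_of_zero, iota_of_zero, map_zero, smul_zero, add_zero]
    exact (iota_of_zero _ _).symm
  | succ p =>
    rw [iota_of_succ, iota_of_succ, iota_of_succ, (isHomogeneous_lie X).apply_of (η.curryLeft Y)]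
    change of p _ + (-1 : ℝ) • of p _ = _
    rw [← map_smul, ← map_add]
    congr 1
    ext1 v
    rw [AlternatingMap.add_apply, AlternatingMap.smul_apply, AlternatingMap.curryLeft_apply_apply,
      AlternatingMap.curryLeft_apply_apply]
    change comp (p + 1) _ _ + (-1 : ℝ) • comp p _ v = _
    rw [comp_lie_of, comp_lie_of, Fin.sum_univ_succ]
    simp only [AlternatingMap.curryLeft_apply_apply, Matrix.vecCons, Fin.cons_zero,
      Fin.update_cons_zero, Fin.cons_succ, Fin.cons_update]
    module

theorem lie_fn (X : SmoothVF E M) (f : SmoothFn E M) : lie X (fn f) = fn (SmoothVF.deriv X f) := by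
  rw [fn, (isHomogeneous_lie X).apply_of]
  refine congrArg (of 0) ?_
  ext1 v
  change comp 0 _ v = _
  rw [comp_lie_of]
  simp

theorem isDer_lie (X : SmoothVF E M) : IsDer 1 (lie X) := by
  refine ⟨isHomogeneous_lie X, fun _ α β => ?_, fun Y => ?_⟩
  · obtain ⟨f, hf⟩ := exists_fn α
    obtain ⟨g, hg⟩ := exists_fn β
    rw [hf, hg, wedge_fn, lie_fn, lie_fn, lie_fn, wedge_fn, wedge_fn, Derivation.leibniz]
    rw [fn, fn, fn, ← map_add]
    refine congrArg (of 0) ?_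
    ext1 v
    simp [mul_comm, add_comm]
  · have h := iota_comm_lie X Y
    rw [← pow_one (-1 : ℝ)] at h
    exact ⟨_, h⟩

/-- The commutator of `d` with `ι_X` is `lie X`, whose commutators with interior products are again
interior products. The Leibniz rule for `d` then follows from `map_wedge`, with no computation with
shuffles. -/
theorem isDer_d : IsDer 2 (d : Module.End ℝ (TForms E M)) := by
  refine ⟨isHomogeneous_d, fun h => absurd h one_ne_zero, fun X => ?_⟩
  have h : (-1 : ℝ) ^ (1 + 1) = 1 := by norm_num
  rw [h, one_smul]
  exact isDer_lie X

theorem d_fn (f : SmoothFn E M) : d (fn f) = ofDual (diff f) := by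
  rw [fn, d_of]
  refine congrArg (of 1) ?_
  ext1 v
  rw [extDer_apply]
  have : v = Fin.cons (v 0) ![] := by
    ext1 i
    obtain rfl : i = 0 := Fin.fin_one_eq_zero i
    rfl
  rw [this, koszulAux_cons_zero]
  rfl

theorem d_ofDual_diff (f : SmoothFn E M) : d (ofDual (diff f)) = 0 := by
  refine (d_of _).trans ?_
  rw [← map_zero (of 2)]
  refine congrArg (of 2) ?_
  ext1 v
  rw [extDer_apply, koszulAux_apply]
  simp only [Fin.sum_univ_succ, Finset.univ_eq_empty, Finset.sum_empty, add_zero,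
    Fin.val_zero, pow_zero, one_smul, Fin.val_succ, zero_add, pow_one, Fin.removeNth,
    AlternatingMap.ofSubsingleton_apply_apply, diff_apply, Function.update_self,
    SmoothVF.deriv_bracket, AlternatingMap.zero_apply]
  simp only [Fin.succAbove_zero, Fin.succ_zero_eq_one, Fin.one_succAbove_zero]
  module

end TForms

end ExteriorDerivative

/-! ### Decomposition of derivations, their commutators, and the formula for the canonical solution.
-/

noncomputable section Decomposition

variable {E : Type*} [NormedAddCommGroup E] [NormedSpace ℝ E] [FiniteDimensional ℝ E]
  {M : Type*} [TopologicalSpace M] [ChartedSpace E M] [IsManifold 𝓘(ℝ, E) ∞ M]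

theorem SmoothVF.eq_of_dual [T2Space M] {Y Z : SmoothVF E M}
    (h : ∀ θ : Module.Dual (SmoothFn E M) (SmoothVF E M), θ Y = θ Z) : Y = Z := by
  rw [← sub_eq_zero]
  refine SmoothVF.eq_zero_of_deriv _ fun f => ?_
  rw [map_sub, Derivation.sub_apply, sub_eq_zero]
  exact h (TForms.diff f)

theorem VForm.eq_of_diff [T2Space M] {n : ℕ} {Θ Θ' : VForm E M n}
    (h : ∀ f, (TForms.diff f).compAlternatingMap Θ = (TForms.diff f).compAlternatingMap Θ') :
    Θ = Θ' := by
  ext1 v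
  rw [← sub_eq_zero]
  refine SmoothVF.eq_zero_of_deriv _ fun f => ?_
  rw [map_sub, Derivation.sub_apply, sub_eq_zero]
  exact congrArg (fun α : DForm E M n => α v) (h f)

namespace TForms

theorem eq_of_ins_diff [T2Space M] {n : ℕ} {Θ Θ' : VForm E M n}
    (h : ∀ f, ins Θ (ofDual (diff f)) = ins Θ' (ofDual (diff f))) : Θ = Θ' :=
  VForm.eq_of_diff fun f => of_injective n (by simpa only [ins_ofDual] using h f)

/-- A graded derivation of `Λ^* M` that vanishes on functions is an insertion operator. -/
theorem IsDer.exists_eq_ins [T2Space M] {n : ℕ} {P : Module.End ℝ (TForms E M)} (hP : IsDer n P)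
    (h0 : ∀ f, P (fn f) = 0) : ∃ Θ : VForm E M n, P = ins Θ := by
  induction n generalizing P with
  | zero =>
    obtain ⟨Y, rfl⟩ := hP
    refine ⟨AlternatingMap.constOfIsEmpty (SmoothFn E M) (SmoothVF E M) (Fin 0) Y, ?_⟩
    rw [ins_zero_form, AlternatingMap.constOfIsEmpty_apply, Function.const_apply]
  | succ n ih =>
    -- The commutator of `P` with `ι_X` again kills functions; the form it yields has to be the
    -- contraction of the desired `Θ` with `X`.
    have h1 : ∀ X, ∃ Θ : VForm E M n,
        iota X * P + (-1 : ℝ) ^ (n + 1) • (P * iota X) = ins Θ := fun X =>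
      ih (hP.comm_iota X) fun f => by
        rw [LinearMap.add_apply, LinearMap.smul_apply, Module.End.mul_apply, Module.End.mul_apply,
          h0, iota_fn, map_zero, map_zero, smul_zero, add_zero]
    choose T hT using h1
    have hP0 : ∀ α : DForm E M 0, P (of 0 α) = 0 := by
      intro α
      obtain ⟨f, hf⟩ := exists_fn α
      rw [hf, h0]
    have key : ∀ (θ : Module.Dual (SmoothFn E M) (SmoothVF E M)) (X : SmoothVF E M)
        (v : Fin n → SmoothVF E M),
        θ (T X v) = comp (n + 1) (P (ofDual θ)) (Fin.cons X v) := by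
      intro θ X v
      have h2 := LinearMap.congr_fun (hT X) (ofDual θ)
      have h3 : P (iota X (ofDual θ)) = 0 := by
        rw [ofDual]
        exact (congrArg P (iota_of_succ X _)).trans (hP0 _)
      rw [LinearMap.add_apply, LinearMap.smul_apply, Module.End.mul_apply, Module.End.mul_apply,
        h3, smul_zero, add_zero, ins_ofDual] at h2
      have h4 := congrArg (fun α : DForm E M n => α v) (congrArg (comp n) h2)
      rw [comp_iota, comp_of] at h4
      exact h4.symm
    have key2 : ∀ (θ : Module.Dual (SmoothFn E M) (SmoothVF E M)) (v : Fin (n + 1) → SmoothVF E M),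
        θ (T (v 0) (Fin.tail v)) = comp (n + 1) (P (ofDual θ)) v := by
      intro θ v
      rw [key, Fin.cons_self_tail]
    -- The chosen `T` carries no linearity or symmetry in `X`. Both come from `key2`, which makes
    -- each pairing with a 1-form `θ` a value of the form `P θ`, since 1-forms separate vector
    -- fields.
    let Θ : VForm E M (n + 1) :=
      { toFun v := T (v 0) (Fin.tail v)
        map_update_add' v i X Y := SmoothVF.eq_of_dual fun θ => by
          simp only [map_add, key2, AlternatingMap.map_update_add]
        map_update_smul' v i f X := SmoothVF.eq_of_dual fun θ => by
          simp only [map_smul, key2, AlternatingMap.map_update_smul]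
        map_eq_zero_of_eq' v i j h hij := SmoothVF.eq_of_dual fun θ => by
          rw [key2, AlternatingMap.map_eq_zero_of_eq _ _ h hij, map_zero] }
    have hΘ : ∀ X, Θ.curryLeft X = T X := by
      intro X
      ext1 v
      rfl
    refine ⟨Θ, end_ext fun p α => ?_⟩
    induction p with
    | zero => rw [hP0, ins_of_zero]
    | succ p ihp =>
      refine eq_of_iota (fun X => ?_) ?_
      · have h2 := LinearMap.congr_fun ((hT X).trans ((congrArg ins (hΘ X)).symm.trans
          (iota_comm_ins Θ X).symm)) (of (p + 1) α)
        simp only [LinearMap.add_apply, LinearMap.smul_apply, Module.End.mul_apply, iota_of_succ,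
          ihp] at h2
        exact add_right_cancel h2
      · rw [hP.1 _ _ _ (by omega), (isDer_ins Θ).1 _ _ _ (by omega)]

/-- `d²` is half of `[d, d]`, hence a derivation. It kills functions, so it is an insertion, and it
kills every `df`, so the inserted form is zero. -/
theorem d_mul_d [T2Space M] : (d * d : Module.End ℝ (TForms E M)) = 0 := by
  have h0 : ∀ f : SmoothFn E M, (d * d : Module.End ℝ (TForms E M)) (fn f) = 0 := by
    intro f
    rw [Module.End.mul_apply, d_fn, d_ofDual_diff]
  have h1 : IsDer 3 (d * d : Module.End ℝ (TForms E M)) := by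
    convert (isDer_d.commutator isDer_d).smul (1 / 2) using 1
    module
  obtain ⟨Θ, hΘ⟩ := h1.exists_eq_ins h0
  have h2 : Θ = 0 := eq_of_ins_diff fun f => by
    rw [← hΘ, map_zero, LinearMap.zero_apply, Module.End.mul_apply, d_ofDual_diff, map_zero]
  rw [hΘ, h2, map_zero]

/-- The Lie derivative `ℒ_Ψ` along a vector valued form. -/
def lieOp {k : ℕ} : VForm E M (k + 1) →ₗ[ℝ] Module.End ℝ (TForms E M) where
  toFun Ψ := ins Ψ * d - (-1 : ℝ) ^ k • (d * ins Ψ)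
  map_add' Ψ Ψ' := by
    rw [map_add, add_mul, mul_add]
    module
  map_smul' c Ψ := by
    rw [map_smul, smul_mul_assoc, mul_smul_comm, RingHom.id_apply]
    module

theorem lieOp_apply {k : ℕ} (Ψ : VForm E M (k + 1)) :
    lieOp Ψ = ins Ψ * d - (-1 : ℝ) ^ k • (d * ins Ψ) := rfl

theorem lieOp_fn {k : ℕ} (Ψ : VForm E M (k + 1)) (f : SmoothFn E M) :
    lieOp Ψ (fn f) = ins Ψ (ofDual (diff f)) := by
  rw [lieOp_apply, LinearMap.sub_apply, LinearMap.smul_apply, Module.End.mul_apply,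
    Module.End.mul_apply, ins_fn, map_zero, smul_zero, sub_zero, d_fn]

theorem isDer_lieOp {k : ℕ} (Ψ : VForm E M (k + 1)) : IsDer (k + 2) (lieOp Ψ) := by
  have h := (isDer_ins Ψ).commutator isDer_d
  rwa [mul_one] at h

/-- On functions the insertion disappears, and `ℒ_Φ f = df ∘ Φ` recovers `Φ`. -/
theorem lieOp_add_ins_unique [T2Space M] {k : ℕ} {Φ Φ' : VForm E M (k + 1)} {l : ℕ}
    {Ψ Ψ' : VForm E M l} (h : lieOp Φ + ins Ψ = lieOp Φ' + ins Ψ') : Φ = Φ' :=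
  eq_of_ins_diff fun f => by
    have h1 := LinearMap.congr_fun h (fn f)
    simpa only [LinearMap.add_apply, ins_fn, add_zero, lieOp_fn] using h1

theorem lieOp_injective [T2Space M] {k : ℕ} :
    Function.Injective (lieOp : VForm E M (k + 1) → Module.End ℝ (TForms E M)) :=
  fun Φ Φ' h => lieOp_add_ins_unique (Ψ := (0 : VForm E M 0)) (Ψ' := 0) (by rw [h])

theorem lift_lieDer {k : ℕ} (Ψ : VForm E M (k + 1)) : lift (lieDer Ψ) = lieOp Ψ := by
  rw [lieDer, lift_gradedComm, lieOp_apply, lift_insertion]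
  have h : (((((k + 1 : ℕ) : ℤ) - 1) * 1).negOnePow : ℤ) = (-1) ^ k := by
    have h2 : ((((k + 1 : ℕ) : ℤ) - 1) * 1) = k := by push_cast; ring
    rw [h2, Int.negOnePow_def]
    simp
  rw [h]
  push_cast
  rfl

/-! ### Commutators -/

/-- Since `D² = 0`, `L = ID - DI` satisfies `LD = -DL`, so `2L²` is minus the anticommutator of `[I,
L]` with `D`. The term `JD - DJ` anticommutes with `D` for any `J`, so it may be subtracted freely;
it is used for `J = ℐ_{Φ²}`. -/
theorem commutator_identity {A : Type*} [Ring A] (I J D : A) (h : D * D = 0) :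
    (I * D - D * I) * (I * D - D * I) + (I * D - D * I) * (I * D - D * I) =
      -((I * (I * D - D * I) - (I * D - D * I) * I - (J * D - D * J)) * D +
        D * (I * (I * D - D * I) - (I * D - D * I) * I - (J * D - D * J))) := by
  have h2 : ∀ x, D * (D * x) = 0 := fun x => by rw [← mul_assoc, h, zero_mul]
  simp only [sub_mul, mul_sub, mul_assoc, h, h2, mul_zero]
  abel

theorem lieOp_toVForm (Φ : EndTM E M) :
    lieOp Φ.toVForm = ins Φ.toVForm * d - d * ins Φ.toVForm := by
  rw [lieOp_apply, pow_zero, one_smul]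

theorem lieOp_toVForm_fn (Φ : EndTM E M) (f : SmoothFn E M) :
    lieOp Φ.toVForm (fn f) = ofDual (diff f ∘ₗ Φ) :=
  (lieOp_fn _ f).trans (ins_toVForm_ofDual Φ _)

/-- On `f` the commutator gives `df ∘ Φ²`, exactly what `ℒ_{Φ²}` removes; rigidity does the rest. -/
theorem exists_commutator [T2Space M] (Φ : EndTM E M) : ∃ Θ : VForm E M 2,
    ins Φ.toVForm * lieOp Φ.toVForm - lieOp Φ.toVForm * ins Φ.toVForm -
      lieOp (Φ * Φ).toVForm = ins Θ := by
  have h := (isDer_ins Φ.toVForm).commutator (isDer_lieOp Φ.toVForm)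
  rw [zero_mul, pow_zero, one_smul] at h
  refine IsDer.exists_eq_ins (h.sub (isDer_lieOp _)) fun f => ?_
  simp only [LinearMap.sub_apply, Module.End.mul_apply, ins_fn, map_zero, lieOp_toVForm_fn,
    ins_toVForm_ofDual, sub_zero]
  exact sub_eq_zero.2 rfl

/-- With `Θ` from `exists_commutator`, `commutator_identity` becomes `[ℒ_Φ, ℒ_Φ] = ℒ_{-Θ}`. This
shows that a bracket exists, and injectivity of `lieOp` forces the chosen one to be `-Θ`. -/
theorem ins_toVForm_lieOp_commutator [T2Space M] (Φ : EndTM E M) :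
    lieOp Φ.toVForm * lieOp Φ.toVForm + lieOp Φ.toVForm * lieOp Φ.toVForm =
      lieOp (fnBracket Φ.toVForm Φ.toVForm) ∧
    ins Φ.toVForm * lieOp Φ.toVForm - lieOp Φ.toVForm * ins Φ.toVForm -
      lieOp (Φ * Φ).toVForm = -ins (fnBracket Φ.toVForm Φ.toVForm) := by
  obtain ⟨Θ, hΘ⟩ := exists_commutator Φ
  have h1 : lieOp Φ.toVForm * lieOp Φ.toVForm + lieOp Φ.toVForm * lieOp Φ.toVForm =
      lieOp (-Θ) := by
    rw [map_neg, lieOp_apply Θ, ← hΘ, pow_one, neg_one_smul, sub_neg_eq_add, lieOp_toVForm,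
      lieOp_toVForm]
    exact commutator_identity _ _ _ d_mul_d
  have h2 : fnBracket Φ.toVForm Φ.toVForm = -Θ := by
    have h3 : lieDer (fnBracket Φ.toVForm Φ.toVForm) =
        gradedComm (1 : ℕ) (1 : ℕ) (lieDer Φ.toVForm) (lieDer Φ.toVForm) := by
      refine Classical.epsilon_spec (p := fun Θ : VForm E M (1 + 1) => lieDer Θ =
        gradedComm (1 : ℕ) (1 : ℕ) (lieDer Φ.toVForm) (lieDer Φ.toVForm)) ⟨-Θ, lift_injective ?_⟩
      rw [Nat.cast_one, lift_gradedComm_one, lift_lieDer, lift_lieDer]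
      exact h1.symm
    refine lieOp_injective ?_
    rw [← h1, ← lift_lieDer, h3, Nat.cast_one, lift_gradedComm_one, lift_lieDer]
  rw [h2]
  exact ⟨h1, by rw [hΘ, map_neg, neg_neg]⟩

/-- On `f` only `ℐ_Ψ (df ∘ Φ) = df ∘ Φ ∘ Ψ` survives, which is `ℒ_{ΦΨ} f`; the difference is an
insertion. This is how `ℵ` comes to multiply by `Φ`. -/
theorem lieOp_ins_commutator [T2Space M] (Φ : EndTM E M) (Ψ : VForm E M 2) :
    ∃ Θ : VForm E M 3, lieOp Φ.toVForm * ins Ψ + ins Ψ * lieOp Φ.toVForm =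
      lieOp (Φ.compAlternatingMap Ψ) + ins Θ := by
  have h := (isDer_lieOp Φ.toVForm).commutator (isDer_ins Ψ)
  rw [mul_one, pow_one, neg_one_smul, sub_neg_eq_add] at h
  obtain ⟨Θ, hΘ⟩ := IsDer.exists_eq_ins (h.sub (isDer_lieOp (Φ.compAlternatingMap Ψ))) fun f => by
    rw [LinearMap.sub_apply, LinearMap.add_apply, Module.End.mul_apply, Module.End.mul_apply,
      ins_fn, map_zero, zero_add, lieOp_toVForm_fn, lieOp_fn, ins_ofDual, ins_ofDual]
    exact sub_eq_zero.2 (congrArg (of 2) rfl)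
  exact ⟨Θ, by rw [← hΘ]; abel⟩

/-- There is no `ℒ`-part, so `ℵ` kills such brackets. -/
theorem ins_ins_commutator [T2Space M] (Ψ Ψ' : VForm E M 2) :
    ∃ Θ : VForm E M 3, ins Ψ * ins Ψ' + ins Ψ' * ins Ψ = ins Θ := by
  have h := (isDer_ins Ψ).commutator (isDer_ins Ψ')
  rw [mul_one, pow_one, neg_one_smul, sub_neg_eq_add] at h
  refine IsDer.exists_eq_ins h fun f => ?_
  simp only [LinearMap.add_apply, Module.End.mul_apply, ins_fn, map_zero, add_zero]

/-! ### The canonical solution of the Maurer-Cartan equation -/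

theorem canonicalSolution_eq [T2Space M] (Φ S : EndTM E M) (hSR : S * (1 + Φ) = 1)
    (hRS : (1 + Φ) * S = 1) :
    act (1 + Φ) * d * act S - d = lieOp Φ.toVForm - (1 / 2 : ℝ) •
      ins (LinearMap.compAlternatingMap S (fnBracket Φ.toVForm Φ.toVForm)) := by
  obtain ⟨b, hb⟩ := IsDer.exists_eq_ins (((isDer_d.conj hSR).sub isDer_d).sub
      (isDer_lieOp Φ.toVForm)) fun f => by
    simp only [LinearMap.sub_apply, Module.End.mul_apply, act_fn, d_fn, lieOp_fn,
      act_one_add_ofDual, add_sub_cancel_left, sub_self]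
  -- The argument `θ ∘ R` is chosen because `act S` returns it to `θ`, which removes the inverse.
  -- What remains is half of the commutator identity `h1` applied to `θ`.
  have key : ∀ θ : Module.Dual (SmoothFn E M) (SmoothVF E M), ins b (ofDual (θ ∘ₗ (1 + Φ))) =
      -((1 / 2 : ℝ) • ins (fnBracket Φ.toVForm Φ.toVForm) (ofDual θ)) := by
    intro θ
    have h1 := LinearMap.congr_fun (ins_toVForm_lieOp_commutator Φ).2 (ofDual θ)
    have h2 : act S (ofDual (θ ∘ₗ (1 + Φ))) = ofDual θ := by
      rw [act_ofDual, LinearMap.comp_assoc, ← Module.End.mul_eq_comp, hRS]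
      rfl
    have h3 : ofDual (θ ∘ₗ (1 + Φ)) = ofDual θ + ins Φ.toVForm (ofDual θ) := by
      rw [← act_ofDual, act_one_add_ofDual]
    have h4 : ins (Φ * Φ).toVForm (ofDual θ) = ins Φ.toVForm (ins Φ.toVForm (ofDual θ)) := by
      rw [ins_toVForm_ofDual, ins_toVForm_ofDual, ins_toVForm_ofDual]
      rfl
    obtain ⟨α, hα⟩ : ∃ α : DForm E M 2, d (ofDual θ) = of 2 α := ⟨_, d_of _⟩
    have h5 := act_one_add_of_two Φ α
    rw [← hα] at h5
    rw [← hb]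
    simp only [LinearMap.sub_apply, Module.End.mul_apply, h2, LinearMap.neg_apply,
      lieOp_toVForm, map_sub, h4] at h1 ⊢
    rw [h5, h3]
    simp only [map_add]
    linear_combination (norm := module) (1 / 2 : ℝ) • h1
  have key2 : ∀ v, (1 + Φ) (b v) = -((1 / 2 : ℝ) • fnBracket Φ.toVForm Φ.toVForm v) := by
    refine fun v => SmoothVF.eq_of_dual fun θ => ?_
    have h1 := key θ
    rw [ins_ofDual, ins_ofDual, ← map_smul, ← map_neg] at h1
    have h2 := congrArg (fun α : DForm E M 2 => α v) (of_injective 2 h1)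
    rw [map_neg, LinearMap.map_smul_of_tower]
    exact h2
  have hb2 : b = -((1 / 2 : ℝ) • LinearMap.compAlternatingMap S
      (fnBracket Φ.toVForm Φ.toVForm)) := by
    ext1 v
    have h1 := congrArg S (key2 v)
    rw [← Module.End.mul_apply, hSR, Module.End.one_apply, map_neg,
      LinearMap.map_smul_of_tower] at h1
    exact h1
  rw [sub_eq_iff_eq_add.1 hb, hb2, map_neg, map_smul]
  abel

end TForms

end Decomposition

/-! ### The recursion for the derivations `γ_k` and their partial sums. -/

noncomputable section Gamma

variable {E : Type*} [NormedAddCommGroup E] [NormedSpace ℝ E] [FiniteDimensional ℝ E]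
  {M : Type*} [TopologicalSpace M] [ChartedSpace E M] [IsManifold 𝓘(ℝ, E) ∞ M]

namespace TForms

/-- Uniqueness of the `ℒ`-part makes the choice in `aleph` immaterial, and the sign `(-1)^2` is
trivial. -/
theorem lift_aleph_two [T2Space M] {D : Module.End ℝ (DForms E M)} {Θ : VForm E M 2}
    {Ψ : VForm E M 3} (h : lift D = lieOp Θ + ins Ψ) : lift (aleph 2 D) = ins Θ := by
  have hD : D = lieDer Θ + insertion Ψ := by
    refine lift_injective ?_
    rw [lift_add, lift_lieDer, h, lift_insertion]
  obtain ⟨Θ', hΘ'⟩ : ∃ Θ' : VForm E M 2, Θ' = Classical.epsilon fun Θ : VForm E M 2 =>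
    ∃ Ψ : VForm E M (2 + 1), D = lieDer Θ + insertion Ψ := ⟨_, rfl⟩
  obtain ⟨Ψ', h1⟩ : ∃ Ψ : VForm E M (2 + 1), D = lieDer Θ' + insertion Ψ := by
    rw [hΘ']
    exact Classical.epsilon_spec (p := fun Θ : VForm E M 2 =>
      ∃ Ψ : VForm E M (2 + 1), D = lieDer Θ + insertion Ψ) ⟨Θ, Ψ, hD⟩
  have h2 := congrArg lift h1
  rw [lift_add, lift_lieDer, lift_insertion, h] at h2
  rw [aleph, ← hΘ', lift_smul, lift_insertion, neg_one_sq, one_smul, lieOp_add_ins_unique h2]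

theorem lift_gammaSeq_one (Φ : EndTM E M) : lift (gammaSeq Φ 1) = lieOp Φ.toVForm := by
  rw [gammaSeq, lift_lieDer]

theorem lift_gammaSeq_add_two [T2Space M] (Φ : EndTM E M) (k : ℕ) :
    lift (gammaSeq Φ (k + 2)) = ((-1 : ℝ) ^ (k + 3) * (1 / 2)) • ins
      (LinearMap.compAlternatingMap (Φ ^ k) (fnBracket Φ.toVForm Φ.toVForm)) := by
  induction k using Nat.strong_induction_on with
  | _ k ih =>
  have h0 : lift (gammaSeq Φ (k + 2)) = -((1 / 2 : ℝ) • ∑ p : Fin (k + 1),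
      lift (aleph 2 (gradedComm 1 1 (gammaSeq Φ (p + 1)) (gammaSeq Φ (k + 1 - p))))) := by
    rw [gammaSeq, lift_neg, lift_smul, lift_sum]
  rw [h0]
  cases k with
  | zero =>
    have h1 : lift (gradedComm 1 1 (gammaSeq Φ 1) (gammaSeq Φ 1)) =
        lieOp (fnBracket Φ.toVForm Φ.toVForm) + ins (0 : VForm E M 3) := by
      rw [lift_gradedComm_one, lift_gammaSeq_one, (ins_toVForm_lieOp_commutator Φ).1, map_zero,
        add_zero]
    refine (congrArg (fun x => -((1 / 2 : ℝ) • x)) (Fin.sum_univ_one _)).trans ?_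
    change -((1 / 2 : ℝ) • lift (aleph 2 (gradedComm 1 1 (gammaSeq Φ 1) (gammaSeq Φ 1)))) = _
    rw [lift_aleph_two h1, pow_zero]
    have h3 : LinearMap.compAlternatingMap (1 : EndTM E M) (fnBracket Φ.toVForm Φ.toVForm) =
        fnBracket Φ.toVForm Φ.toVForm := rfl
    rw [h3]
    module
  | succ j =>
    obtain ⟨c, hc⟩ : ∃ c, c = (-1 : ℝ) ^ (j + 3) * (1 / 2) := ⟨_, rfl⟩
    obtain ⟨Ψ, hΨ⟩ : ∃ Ψ : VForm E M 2, Ψ =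
      LinearMap.compAlternatingMap (Φ ^ j) (fnBracket Φ.toVForm Φ.toVForm) := ⟨_, rfl⟩
    have hj : lift (gammaSeq Φ (j + 2)) = c • ins Ψ := by rw [hc, hΨ, ih j (by omega)]
    obtain ⟨Θ, hΘ⟩ := lieOp_ins_commutator Φ Ψ
    have h1 : lift (gradedComm 1 1 (gammaSeq Φ 1) (gammaSeq Φ (j + 2))) =
        lieOp (c • LinearMap.compAlternatingMap Φ Ψ) + ins (c • Θ) := by
      rw [lift_gradedComm_one, lift_gammaSeq_one, hj, map_smul, map_smul, ← smul_add, ← hΘ,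
        smul_add, mul_smul_comm, smul_mul_assoc]
    have h2 : lift (gradedComm 1 1 (gammaSeq Φ (j + 2)) (gammaSeq Φ 1)) =
        lieOp (c • LinearMap.compAlternatingMap Φ Ψ) + ins (c • Θ) := by
      rw [← h1, lift_gradedComm_one, lift_gradedComm_one, add_comm]
    have h3 : ∀ a b, a < j → b < j →
        lift (aleph 2 (gradedComm 1 1 (gammaSeq Φ (a + 2)) (gammaSeq Φ (b + 2)))) = 0 := by
      intro a b ha hb
      obtain ⟨Θ', hΘ'⟩ := ins_ins_commutator
        (((-1 : ℝ) ^ (a + 3) * (1 / 2)) •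
          LinearMap.compAlternatingMap (Φ ^ a) (fnBracket Φ.toVForm Φ.toVForm))
        (((-1 : ℝ) ^ (b + 3) * (1 / 2)) •
          LinearMap.compAlternatingMap (Φ ^ b) (fnBracket Φ.toVForm Φ.toVForm))
      have h4 : lift (gradedComm 1 1 (gammaSeq Φ (a + 2)) (gammaSeq Φ (b + 2))) =
          lieOp (0 : VForm E M 2) + ins Θ' := by
        rw [lift_gradedComm_one, ih a (by omega), ih b (by omega), map_zero, zero_add, ← hΘ',
          map_smul, map_smul]
      rw [lift_aleph_two h4, map_zero]
    have hlast : j + 1 + 1 - (j + 1) = 1 := by omega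
    have hfst : j + 1 + 1 - 0 = j + 2 := rfl
    -- The first and last summands pair `γ_1` with `γ_{j+2}` and agree by symmetry of the bracket;
    -- together they cancel the factor `½` and leave the sign. The middle ones are brackets of two
    -- insertions.
    rw [Fin.sum_univ_succ, Fin.sum_univ_castSucc, Finset.sum_eq_zero]
    · simp only [Fin.val_zero, Fin.val_succ, Fin.val_last, zero_add, hlast, hfst,
        lift_aleph_two h1]
      rw [lift_aleph_two h2, map_smul, hΨ, hc]
      have h5 : LinearMap.compAlternatingMap Φ (LinearMap.compAlternatingMap (Φ ^ j)
          (fnBracket Φ.toVForm Φ.toVForm)) = LinearMap.compAlternatingMap (Φ ^ (j + 1))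
          (fnBracket Φ.toVForm Φ.toVForm) := by
        rw [pow_succ']
        rfl
      rw [h5, pow_succ _ (j + 3)]
      module
    · intro i _
      -- In the middle range the indices are `i + 2` and `(j - 1 - i) + 2`, so both factors are
      -- insertions by induction.
      have hi : j + 1 + 1 - ((i.castSucc.succ : Fin (j + 2)) : ℕ) = (j - 1 - i) + 2 := by
        have := i.2
        simp only [Fin.val_succ, Fin.val_castSucc]
        omega
      rw [hi]
      exact h3 i (j - 1 - i) i.2 (by have := i.2; omega)

theorem isGradedDerivation_gammaSeq [T2Space M] (Φ : EndTM E M) (k : ℕ) (hk : 1 ≤ k) :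
    IsGradedDerivation 1 (gammaSeq Φ k) := by
  refine isGradedDerivation_of_isDer ?_
  obtain rfl | ⟨k, rfl⟩ : k = 1 ∨ ∃ j, k = j + 2 := by
    rcases k with _ | _ | k
    · omega
    · exact Or.inl rfl
    · exact Or.inr ⟨k, rfl⟩
  · rw [lift_gammaSeq_one]
    exact isDer_lieOp _
  · rw [lift_gammaSeq_add_two]
    exact (isDer_ins _).smul _

/-- `γ_{h+2}` carries `-½ (-1)^h Φ^h`, so the sum up to `N + 1` matches the first `N` terms of the
Neumann series. -/
theorem sum_lift_gammaSeq [T2Space M] (Φ : EndTM E M) (N : ℕ) :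
    lift (∑ k ∈ Finset.Icc 2 (N + 1), gammaSeq Φ k) = -((1 / 2 : ℝ) • ins
      (LinearMap.compAlternatingMap (∑ h ∈ Finset.range N, (-1 : ℝ) ^ h • Φ ^ h)
        (fnBracket Φ.toVForm Φ.toVForm))) := by
  induction N with
  | zero =>
    have h1 : LinearMap.compAlternatingMap (0 : EndTM E M) (fnBracket Φ.toVForm Φ.toVForm) = 0 :=
      rfl
    rw [Finset.sum_range_zero, h1, map_zero, smul_zero, neg_zero, zero_add,
      Finset.Icc_eq_empty (by omega), Finset.sum_empty, lift_zero]
  | succ N ih =>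
    have h1 : ∀ (A B : EndTM E M) (c : ℝ) (Ψ : VForm E M (1 + 1)),
        LinearMap.compAlternatingMap (A + c • B) Ψ =
          LinearMap.compAlternatingMap A Ψ + c • LinearMap.compAlternatingMap B Ψ :=
      fun A B c Ψ => rfl
    rw [Finset.sum_Icc_succ_top (by omega), lift_add, ih, lift_gammaSeq_add_two,
      Finset.sum_range_succ, h1, map_add, map_smul, pow_add]
    module

theorem lift_canonicalSolution [T2Space M] (Φ : EndTM E M) (hinv : IsUnit (1 + Φ)) :
    lift (canonicalSolution Φ) = lieOp Φ.toVForm - (1 / 2 : ℝ) •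
      ins (LinearMap.compAlternatingMap (Ring.inverse (1 + Φ))
        (fnBracket Φ.toVForm Φ.toVForm)) :=
  canonicalSolution_eq Φ _ (Ring.inverse_mul_cancel _ hinv) (Ring.mul_inverse_cancel _ hinv)

theorem lift_insertion_bForm (Φ : EndTM E M) :
    lift (insertion (bForm Φ)) = -((1 / 2 : ℝ) •
      ins (LinearMap.compAlternatingMap (Ring.inverse (1 + Φ))
        (fnBracket Φ.toVForm Φ.toVForm))) := by
  rw [lift_insertion, bForm, map_neg, map_smul]

end TForms

end Gamma

/-! ### Transfer of convergence from endomorphisms to insertion operators. -/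

noncomputable section Convergence

variable {E : Type*} [NormedAddCommGroup E] [NormedSpace ℝ E]
  {M : Type*} [TopologicalSpace M] [ChartedSpace E M]

/-- The closure properties of a notion of convergence of sequences of smooth functions under
linear operations and shifts. -/
structure IsLinearConvergence (conv : (ℕ → SmoothFn E M) → SmoothFn E M → Prop) : Prop where
  const : ∀ f, conv (fun _ => f) f
  add : ∀ {F G f g}, conv F f → conv G g → conv (fun N => F N + G N) (f + g)
  smul : ∀ (c : ℝ) {F f}, conv F f → conv (fun N => c • F N) (c • f)
  of_shift : ∀ {F f}, conv (fun N => F (N + 1)) f → conv F f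

theorem isLinearConvergence_convergesPointwise :
    IsLinearConvergence (ConvergesPointwise : (ℕ → SmoothFn E M) → SmoothFn E M → Prop) where
  const _ _ := tendsto_const_nhds
  add hF hG x := (hF x).add (hG x)
  smul c _ _ hF x := (hF x).const_smul c
  of_shift hF x := (Filter.tendsto_add_atTop_iff_nat 1).1 (hF x)

variable [IsManifold 𝓘(ℝ, E) ∞ M]

theorem iteratedLieDeriv_add (l : List (SmoothVF E M)) (f g : SmoothFn E M) :
    iteratedLieDeriv l (f + g) = iteratedLieDeriv l f + iteratedLieDeriv l g := by
  induction l with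
  | nil => rfl
  | cons X l ih => rw [iteratedLieDeriv, iteratedLieDeriv, iteratedLieDeriv, ih, map_add]

theorem iteratedLieDeriv_smul (l : List (SmoothVF E M)) (c : ℝ) (f : SmoothFn E M) :
    iteratedLieDeriv l (c • f) = c • iteratedLieDeriv l f := by
  induction l with
  | nil => rfl
  | cons X l ih => rw [iteratedLieDeriv, iteratedLieDeriv, ih, Derivation.map_smul]

theorem isLinearConvergence_convergesSmoothly :
    IsLinearConvergence (ConvergesSmoothly : (ℕ → SmoothFn E M) → SmoothFn E M → Prop) where
  const f l u hu x := ⟨Set.univ, Filter.univ_mem,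
    Filter.Eventually.of_forall fun _ _ _ => refl_mem_uniformity hu⟩
  add {F G f g} hF hG l := by
    simp only [iteratedLieDeriv_add]
    exact (hF l).add (hG l)
  smul c {F f} hF l := by
    simp only [iteratedLieDeriv_smul]
    exact (uniformContinuous_const_smul c).comp_tendstoLocallyUniformly (hF l)
  of_shift {F f} hF l u hu x := by
    obtain ⟨t, ht, h⟩ := hF l u hu x
    refine ⟨t, ht, ?_⟩
    rw [← Filter.map_add_atTop_eq_nat 1]
    exact h

namespace TForms

theorem comp_zero_ins {k : ℕ} (Ψ : VForm E M (k + 1)) (w : TForms E M) :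
    comp 0 (ins Ψ w) = 0 := by
  have h : (of 0 ∘ₗ comp 0) * ins Ψ = (0 : Module.End ℝ (TForms E M)) := by
    refine end_ext fun p α => ?_
    rw [Module.End.mul_apply, LinearMap.comp_apply, LinearMap.zero_apply]
    cases p with
    | zero => rw [ins_of_zero, map_zero, map_zero]
    | succ p => rw [ins_of_succ, comp_of_ne (by omega), map_zero]
  exact of_injective 0 ((LinearMap.congr_fun h w).trans (map_zero (of 0)).symm)

theorem tendsto_ins_zero {conv : (ℕ → SmoothFn E M) → SmoothFn E M → Prop}
    {A : ℕ → EndTM E M} {B : EndTM E M} (hA : EndTM.Converges conv A B) (Ψ : VForm E M 0)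
    (w : TForms E M) (n : ℕ) (u : ℕ → SmoothVF E M) :
    conv (fun N => (comp n (ins ((A N).compAlternatingMap Ψ) w)).evSeq u)
      ((comp n (ins (B.compAlternatingMap Ψ) w)).evSeq u) := by
  have h : ∀ C : EndTM E M, (comp n (ins (C.compAlternatingMap Ψ) w)).evSeq u =
      splitFirst n (comp (n + 1) w) (fun i => u i) (C (Ψ ![])) := by
    intro C
    rw [ins_zero_form, comp_iota_evSeq, AlternatingMap.evSeq_seqCons]
    rfl
  simp only [h]
  exact hA _ _

/-- Each evaluated argument `X` is contracted either into `Ψ` or into `w`. After finitely many steps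
each term is zero or has `Ψ` reduced to a vector field `Y`; in the latter case it is a 1-form
applied to `A N Y`, which converges by assumption. -/
theorem tendsto_ins {conv : (ℕ → SmoothFn E M) → SmoothFn E M → Prop}
    (hconv : IsLinearConvergence conv) {A : ℕ → EndTM E M} {B : EndTM E M}
    (hA : EndTM.Converges conv A B) {k : ℕ} (Ψ : VForm E M k) (w : TForms E M) (n : ℕ)
    (u : ℕ → SmoothVF E M) :
    conv (fun N => (comp n (ins ((A N).compAlternatingMap Ψ) w)).evSeq u)
      ((comp n (ins (B.compAlternatingMap Ψ) w)).evSeq u) := by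
  induction n generalizing k w u with
  | zero =>
    cases k with
    | zero => exact tendsto_ins_zero hA Ψ w 0 u
    | succ k =>
      simp only [comp_zero_ins]
      exact hconv.const _
  | succ n ih =>
    cases k with
    | zero => exact tendsto_ins_zero hA Ψ w (n + 1) u
    | succ k =>
      obtain ⟨X, v, rfl⟩ := exists_seqCons u
      have h : ∀ C : EndTM E M,
          (comp (n + 1) (ins (C.compAlternatingMap Ψ) w)).evSeq (seqCons X v) =
          (comp n (ins (C.compAlternatingMap (Ψ.curryLeft X)) w)).evSeq v + (-1 : ℝ) ^ k •
            (comp n (ins (C.compAlternatingMap Ψ) (iota X w))).evSeq v := by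
        intro C
        rw [← comp_iota_evSeq, ← Module.End.mul_apply, iota_mul_ins]
        rfl
      simp only [h]
      exact hconv.add (ih _ _ _) (hconv.smul _ (ih _ _ _))

end TForms

end Convergence

/-! ### Assembly of the three statements. -/

noncomputable section Main

variable {E : Type*} [NormedAddCommGroup E] [NormedSpace ℝ E]
  {M : Type*} [TopologicalSpace M] [ChartedSpace E M] [IsManifold 𝓘(ℝ, E) ∞ M]

theorem operatorConverges_of_lift {conv : (ℕ → SmoothFn E M) → SmoothFn E M → Prop}
    (hconv : IsLinearConvergence conv) {A : ℕ → Module.End ℝ (DForms E M)}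
    {B : Module.End ℝ (DForms E M)}
    (h : ∀ (w : TForms E M) (n : ℕ) (u : ℕ → SmoothVF E M),
      conv (fun N => (TForms.comp n (TForms.lift (A (N + 1)) w)).evSeq u)
        ((TForms.comp n (TForms.lift B w)).evSeq u)) : OperatorConverges conv A B := by
  intro σ q v
  -- The shift aligns sums up to `N + 1` with `N` terms of the Neumann series.
  refine hconv.of_shift ?_
  have hv : v = fun i : Fin q => (fun k => if h : k < q then v ⟨k, h⟩ else 0) (i : ℕ) := by
    ext1 i
    simp
  have h1 := h σ q fun k => if h : k < q then v ⟨k, h⟩ else 0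
  rw [hv]
  exact h1

end Main

theorem mainTheorem8 {E : Type*} [NormedAddCommGroup E] [NormedSpace ℝ E] [FiniteDimensional ℝ E]
    {M : Type*} [TopologicalSpace M] [T2Space M] [SecondCountableTopology M] [ChartedSpace E M]
    [IsManifold 𝓘(ℝ, E) ∞ M] (Φ : EndTM E M) (hinv : IsUnit (1 + Φ))
    (conv : (ℕ → SmoothFn E M) → SmoothFn E M → Prop)
    (hconv : conv = ConvergesPointwise ∨ conv = ConvergesSmoothly)
    (hsum : EndTM.Converges conv (fun N => ∑ h ∈ Finset.range N, (-1 : ℝ) ^ h • Φ ^ h)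
      (Ring.inverse (1 + Φ))) :
    ((∀ k, 1 ≤ k → IsGradedDerivation 1 (gammaSeq Φ k)) ∧
      OperatorConverges conv (fun N => ∑ k ∈ Finset.Icc 1 N, gammaSeq Φ k)
        (canonicalSolution Φ)) ∧
    (∀ k, 2 ≤ k → gammaSeq Φ k = ((-1 : ℝ) ^ (k + 1) * (1 / 2)) • insertion
      (LinearMap.compAlternatingMap (Φ ^ (k - 2)) (fnBracket Φ.toVForm Φ.toVForm))) ∧
    OperatorConverges conv (fun N => ∑ k ∈ Finset.Icc 2 N, gammaSeq Φ k)
      (insertion (bForm Φ)) := by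
  have hlin : IsLinearConvergence conv := by
    rcases hconv with rfl | rfl
    · exact isLinearConvergence_convergesPointwise
    · exact isLinearConvergence_convergesSmoothly
  have htail : ∀ (w : TForms E M) (n : ℕ) (u : ℕ → SmoothVF E M),
      conv (fun N => (TForms.comp n (TForms.lift
          (∑ k ∈ Finset.Icc 2 (N + 1), gammaSeq Φ k) w)).evSeq u)
        ((TForms.comp n (TForms.lift (insertion (bForm Φ)) w)).evSeq u) := by
    intro w n u
    have h : ∀ Ψ : VForm E M (1 + 1),
        (TForms.comp n ((-((1 / 2 : ℝ) • TForms.ins Ψ) : Module.End ℝ (TForms E M)) w)).evSeq u =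
        (-(1 / 2) : ℝ) • (TForms.comp n (TForms.ins Ψ w)).evSeq u := by
      intro Ψ
      rw [← neg_smul, LinearMap.smul_apply, map_smul]
      rfl
    simp only [TForms.sum_lift_gammaSeq, TForms.lift_insertion_bForm, h]
    exact hlin.smul _ (TForms.tendsto_ins hlin hsum _ w n u)
  refine ⟨⟨TForms.isGradedDerivation_gammaSeq Φ, ?_⟩, fun k hk => ?_, ?_⟩
  · refine operatorConverges_of_lift hlin fun w n u => ?_
    have h1 : ∀ N, TForms.lift (∑ k ∈ Finset.Icc 1 (N + 1), gammaSeq Φ k) =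
        TForms.lift (gammaSeq Φ 1) + TForms.lift (∑ k ∈ Finset.Icc 2 (N + 1), gammaSeq Φ k) := by
      intro N
      rw [← TForms.lift_add, ← Finset.add_sum_Ioc_eq_sum_Icc (by omega)]
      -- On `ℕ`, `Ioc 1` and `Icc 2` agree by definition.
      rfl
    have h2 : TForms.lift (canonicalSolution Φ) =
        TForms.lift (gammaSeq Φ 1) + TForms.lift (insertion (bForm Φ)) := by
      rw [TForms.lift_canonicalSolution Φ hinv, TForms.lift_insertion_bForm,
        TForms.lift_gammaSeq_one, sub_eq_add_neg]
    have h3 : ∀ P Q : Module.End ℝ (TForms E M), (TForms.comp n ((P + Q) w)).evSeq u =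
        (TForms.comp n (P w)).evSeq u + (TForms.comp n (Q w)).evSeq u := by
      intro P Q
      rw [LinearMap.add_apply, map_add]
      rfl
    simp only [h1, h2, h3]
    exact hlin.add (hlin.const _) (htail w n u)
  · obtain ⟨j, rfl⟩ := Nat.exists_eq_add_of_le' hk
    exact TForms.lift_injective (TForms.lift_gammaSeq_add_two Φ j)
  · exact operatorConverges_of_lift hlin htail
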